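/- Let $\mathbf k$ be a field of characteristic $0$; all vector spaces are over $\mathbf k$, $\sigma$ is the flip, and $L_\diamond(a)b=a\diamond b=R_\diamond(b)a$. **Definitions.** A *perm algebra* satisfies $p\cdot(q\cdot r)=(p\cdot q)\cdot r=(q\cdot p)\cdot r$. A *pre-Lie algebra* satisfies $(a\diamond b)\diamond c-a\diamond(b\diamond c)=(b\diamond a)\diamond c-b\diamond(a\diamond c)$. A *pre-Lie coalgebra* is a space $A$ with a linear map $\Delta_A:A\to A\otimes A$ such that $(\Delta_A\otimes\mathrm{id})\Delta_A-(\sigma\otimes\mathrm{id})(\Delta_A\otimes\mathrm{id})\Delta_A=(\mathrm{id}\otimes\Delta_A)\Delta_A-(\sigma\otimes\mathrm{id})(\mathrm{id}\otimes\Delta_A)\Delta_A$. A *pre-Lie bialgebra* $(A,\diamond,\Delta_A)$ is a pre-Lie algebra and pre-Lie coalgebra with $\zeta(b,a)=\zeta(a,b)=\sigma(\zeta(a,b))$ for all $a,b\in A$, where $$\zeta(a,b)=\Delta_A(a\diamond b)-(L_\diamond(a)\otimes\mathrm{id}+\mathrm{id}\otimes L_\diamond(a))\Delta_A(b)-(\mathrm{id}\otimes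 R_\diamond(b))\Delta_A(a).$$ Let $G$ be an abelian group. A *quadratic $G$-graded perm algebra* $(P,\cdot,\kappa)$ is a perm algebra $P=\bigoplus_{g\in G}P_g$ with all $P_g$ finite-dimensional and $P_g\cdot P_h\subset P_{g+h}$, with a skew-symmetric nondegenerate bilinear form $\kappa$ such that $\kappa(p\cdot q,r)=\kappa(p,q\cdot r-r\cdot q)$ and, for some $d\in G$, $\kappa(P_g,P_h)=0$ whenever $g+h\ne d$. For a $G$-graded space $V=\bigoplus_g V_g$ put $V\hat\otimes V=\prod_{g,h}V_g\otimes V_h$ (similarly for three factors), with completed flip $\hat\sigma$; for a linear map $f$ from $V$ to $V$ or to $V\hat\otimes V$, each component of which vanishes on all but finitely many $V_g$ ("locally finite"), let $f\hat\otimes\mathrm{id}$ and $\mathrm{id}\hat\otimes f$ be the componentwise extensions. A *completed Lie bialgebra* is a $G$-graded space $L$ with a Lie bracket $[-,-]$ and a linear map $\delta:L\to L\hat\otimes L$ such that $\delta$ and all maps $\mathrm{ad}(x)=[x,-]$ are locally finite and, for all $x,y\in L$, $\delta(x)+\hat\sigma\delta(x)=0$, $(\mathrm{id}\hat\otimes\delta)\delta(x)-(\hat\sigma\hat\otimes\mathrm{id})(\mathrm{id}\hat\otimes\delta)\delta(x)-(\delta\hat\otimes\mathrm{id})\delta(x)=0$,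 and $$\delta([x,y])=(\mathrm{ad}(x)\hat\otimes\mathrm{id}+\mathrm{id}\hat\otimes\mathrm{ad}(x))\delta(y)-(\mathrm{ad}(y)\hat\otimes\mathrm{id}+\mathrm{id}\hat\otimes\mathrm{ad}(y))\delta(x).$$ **Construction.** Let $A$ be a vector space (of any dimension) with a bilinear product $\diamond$ and a linear map $\Delta_A:A\to A\otimes A$, and let $(P,\cdot,\kappa)$ be a quadratic $G$-graded perm algebra. Let $\Delta_P:P\to P\hat\otimes P$ be the linear map with $\tilde\kappa(\Delta_P(p),q\otimes r)=-\kappa(p,q\cdot r)$ for all $p,q,r\in P$, where $\tilde\kappa(\sum v_i\otimes w_j,q\otimes r)=\sum\kappa(v_i,q)\kappa(w_j,r)$. Grade $L=A\otimes P$ by $L_g=A\otimes P_g$ and set $$[a\otimes p,b\otimes q]=(a\diamond b)\otimes(p\cdot q)-(b\diamond a)\otimes(q\cdot p),\qquad \delta(a\otimes p)=(\mathrm{id}-\hat\sigma)(\Delta_A(a)\bullet\Delta_P(p)),$$ where $(a\otimes b)\bullet\sum p_i\otimes q_j=\sum(a\otimes p_i)\otimes(b\otimes q_j)$. **Theorem.**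 1. For every quadratic $\mathbb Z$-graded perm algebra $(P,\cdot,\kappa)$ the map $\Delta_P$ exists and is unique. If moreover $(A,\diamond,\Delta_A)$ is a pre-Lie bialgebra, then $(L,[-,-],\delta)$ is a completed Lie bialgebra. If $A$ is finite-dimensional, so are all $L_i$. 2. Let $P=\{f_1\partial_1+f_2\partial_2: f_1,f_2\in\mathbf k[x_1^{\pm},x_2^{\pm}]\}$ with $(x_1^{i_1}x_2^{i_2}\partial_s)\cdot(x_1^{j_1}x_2^{j_2}\partial_t)=x_s\,x_1^{i_1+j_1}x_2^{i_2+j_2}\partial_t$, with $\kappa(x_1^{i_1}x_2^{i_2}\partial_2,x_1^{j_1}x_2^{j_2}\partial_1)=-\kappa(x_1^{j_1}x_2^{j_2}\partial_1,x_1^{i_1}x_2^{i_2}\partial_2)=\delta_{i_1+j_1,0}\delta_{i_2+j_2,0}$ and $\kappa=0$ on two monomials with the same $\partial_s$, graded by $\mathbb Z^2$, where $x_1^{i_1}x_2^{i_2}\partial_1$ has degree $(i_1+1,i_2)$ and $x_1^{i_1}x_2^{i_2}\partial_2$ has degree $(i_1,i_2+1)$. Then $(P,\cdot,\kappa)$ is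 a quadratic $\mathbb Z^2$-graded perm algebra, $\Delta_P$ exists and is unique, and for arbitrary $(A,\diamond,\Delta_A)$ as in the construction, $(L,[-,-],\delta)$ is a completed Lie bialgebra if and only if $(A,\diamond,\Delta_A)$ is a pre-Lie bialgebra. Moreover all $L_g$ are finite-dimensional if and only if $A$ is. -/

import Mathlib

open scoped TensorProduct DirectSum

set_option maxSynthPendingDepth 3

namespace AffineBialgebra

noncomputable section

/-! ### Perm algebras, pre-Lie algebras, pre-Lie coalgebras, pre-Lie bialgebras -/

/-- `p · (q · r) = (p · q) · r = (q · p) · r`. -/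
def IsPerm {k P : Type*} [Field k] [AddCommGroup P] [Module k P]
    (m : P →ₗ[k] P →ₗ[k] P) : Prop :=
  ∀ p q r : P, m p (m q r) = m (m p q) r ∧ m (m p q) r = m (m q p) r

/-- The (left) pre-Lie identity: the associator is symmetric in the first two arguments. -/
def IsPreLie {k A : Type*} [Field k] [AddCommGroup A] [Module k A]
    (m : A →ₗ[k] A →ₗ[k] A) : Prop :=
  ∀ a b c : A, m (m a b) c - m a (m b c) = m (m b a) c - m b (m a c)

/-- `(Δ ⊗ id)Δ - (σ ⊗ id)(Δ ⊗ id)Δ = (id ⊗ Δ)Δ - (σ ⊗ id)(id ⊗ Δ)Δ`, as an identity in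
`(A ⊗ A) ⊗ A`. -/
def IsPreLieCoalgebra {k A : Type*} [Field k] [AddCommGroup A] [Module k A]
    (Δ : A →ₗ[k] A ⊗[k] A) : Prop :=
  ∀ a : A,
    Δ.rTensor A (Δ a)
        - (TensorProduct.comm k A A).toLinearMap.rTensor A (Δ.rTensor A (Δ a))
      = (TensorProduct.assoc k A A A).symm (Δ.lTensor A (Δ a))
        - (TensorProduct.comm k A A).toLinearMap.rTensor A
            ((TensorProduct.assoc k A A A).symm (Δ.lTensor A (Δ a)))

/-- `ζ(a, b) = Δ(a ⋄ b) - (L(a) ⊗ id + id ⊗ L(a)) Δ(b) - (id ⊗ R(b)) Δ(a)`. -/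
def zeta {k A : Type*} [Field k] [AddCommGroup A] [Module k A]
    (m : A →ₗ[k] A →ₗ[k] A) (Δ : A →ₗ[k] A ⊗[k] A) (a b : A) : A ⊗[k] A :=
  Δ (m a b) - ((m a).rTensor A (Δ b) + (m a).lTensor A (Δ b)) - (m.flip b).lTensor A (Δ a)

structure IsPreLieBialgebra {k A : Type*} [Field k] [AddCommGroup A] [Module k A]
    (m : A →ₗ[k] A →ₗ[k] A) (Δ : A →ₗ[k] A ⊗[k] A) : Prop where
  preLie : IsPreLie m
  preLieCoalgebra : IsPreLieCoalgebra Δ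
  zeta_comm : ∀ a b : A, zeta m Δ b a = zeta m Δ a b
  zeta_symm : ∀ a b : A, TensorProduct.comm k A A (zeta m Δ a b) = zeta m Δ a b

/-! ### Completed tensor products of graded vector spaces

A grading of `V` by an abelian group `G` is a family `𝒱 : G → Submodule k V` with
`[DirectSum.Decomposition 𝒱]`. -/

/-- The completed tensor product `∏_{i, j} 𝒱 i ⊗ 𝒲 j`. -/
abbrev CompletedTensor {k V W G : Type*} [Field k] [AddCommGroup V] [Module k V]
    [AddCommGroup W] [Module k W] (𝒱 : G → Submodule k V) (𝒲 : G → Submodule k W) : Type _ :=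
  ∀ t : G × G, 𝒱 t.1 ⊗[k] 𝒲 t.2

/-- The completed flip. -/
def flipHat {k V G : Type*} [Field k] [AddCommGroup V] [Module k V] (𝒱 : G → Submodule k V) :
    CompletedTensor 𝒱 𝒱 →ₗ[k] CompletedTensor 𝒱 𝒱 :=
  LinearMap.pi fun t =>
    (TensorProduct.comm k (𝒱 t.2) (𝒱 t.1)).toLinearMap ∘ₗ LinearMap.proj (t.2, t.1)

/-- The inclusion of `V = ⨁ 𝒱 g` into `∏ 𝒱 g`. -/
def toPi {k V G : Type*} [Field k] [AddCommGroup V] [Module k V] [DecidableEq G]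
    (𝒱 : G → Submodule k V) [DirectSum.Decomposition 𝒱] : V →ₗ[k] ∀ g, 𝒱 g :=
  LinearMap.pi fun g =>
    DirectSum.component k G (fun g => 𝒱 g) g ∘ₗ (DirectSum.decomposeLinearEquiv 𝒱).toLinearMap

/-- `f : V → ∏_t E t` is locally finite if each component of `f` vanishes on all but finitely many
of the homogeneous subspaces of `V`. This is what makes the infinite sums defining
`f ⊗̂ id` and `id ⊗̂ f` below finite in every component. -/
def LocallyFinite {k V G T : Type*} {E : T → Type*} [Field k] [AddCommGroup V] [Module k V]
    [∀ t, AddCommGroup (E t)] [∀ t, Module k (E t)] (𝒱 : G → Submodule k V)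
    (f : V →ₗ[k] ∀ t, E t) : Prop :=
  ∀ t : T, {g : G | ∃ v ∈ 𝒱 g, f v t ≠ 0}.Finite

/-- `f ⊗̂ id`, sending `∑ v_i ⊗ w_j` to `∑ f(v_i) ⊗ w_j` (for locally finite `f`). -/
def mapLeftHat {k V W G T : Type*} {E : T → Type*} [Field k] [AddCommGroup V] [Module k V]
    [AddCommGroup W] [Module k W] [∀ t, AddCommGroup (E t)] [∀ t, Module k (E t)]
    (𝒱 : G → Submodule k V) (𝒲 : G → Submodule k W) (f : V →ₗ[k] ∀ t, E t)
    (x : CompletedTensor 𝒱 𝒲) : ∀ s : T × G, E s.1 ⊗[k] 𝒲 s.2 :=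
  fun s => ∑ᶠ g : G,
    ((LinearMap.proj s.1 ∘ₗ f) ∘ₗ (𝒱 g).subtype).rTensor (𝒲 s.2) (x (g, s.2))

/-- `id ⊗̂ f`, sending `∑ v_i ⊗ w_j` to `∑ v_i ⊗ f(w_j)` (for locally finite `f`). -/
def mapRightHat {k V W G T : Type*} {E : T → Type*} [Field k] [AddCommGroup V] [Module k V]
    [AddCommGroup W] [Module k W] [∀ t, AddCommGroup (E t)] [∀ t, Module k (E t)]
    (𝒱 : G → Submodule k V) (𝒲 : G → Submodule k W) (f : W →ₗ[k] ∀ t, E t)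
    (x : CompletedTensor 𝒱 𝒲) : ∀ s : G × T, 𝒱 s.1 ⊗[k] E s.2 :=
  fun s => ∑ᶠ g : G,
    ((LinearMap.proj s.2 ∘ₗ f) ∘ₗ (𝒲 g).subtype).lTensor (𝒱 s.1) (x (s.1, g))

/-- The threefold completed tensor product `∏_{i, j, l} (𝒱 i ⊗ 𝒱 j) ⊗ 𝒱 l`. -/
abbrev CompletedTensor₃ {k V G : Type*} [Field k] [AddCommGroup V] [Module k V]
    (𝒱 : G → Submodule k V) : Type _ :=
  ∀ s : (G × G) × G, (𝒱 s.1.1 ⊗[k] 𝒱 s.1.2) ⊗[k] 𝒱 s.2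

/-- Reassociation of `∏ 𝒱 i ⊗ (𝒱 j ⊗ 𝒱 l)` to `∏ (𝒱 i ⊗ 𝒱 j) ⊗ 𝒱 l`. -/
def assocHat {k V G : Type*} [Field k] [AddCommGroup V] [Module k V] (𝒱 : G → Submodule k V)
    (x : ∀ s : G × (G × G), 𝒱 s.1 ⊗[k] (𝒱 s.2.1 ⊗[k] 𝒱 s.2.2)) : CompletedTensor₃ 𝒱 :=
  fun s => (TensorProduct.assoc k (𝒱 s.1.1) (𝒱 s.1.2) (𝒱 s.2)).symm (x (s.1.1, (s.1.2, s.2)))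

/-- `σ̂ ⊗̂ id` on the threefold completed tensor product. -/
def flipLeftHat {k V G : Type*} [Field k] [AddCommGroup V] [Module k V] (𝒱 : G → Submodule k V)
    (x : CompletedTensor₃ 𝒱) : CompletedTensor₃ 𝒱 :=
  fun s => (TensorProduct.comm k (𝒱 s.1.2) (𝒱 s.1.1)).toLinearMap.rTensor (𝒱 s.2)
    (x ((s.1.2, s.1.1), s.2))

/-! ### Completed Lie coalgebras and completed Lie bialgebras -/

structure IsLieBracket {k L : Type*} [Field k] [AddCommGroup L] [Module k L]
    (br : L →ₗ[k] L →ₗ[k] L) : Prop where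
  alternating : ∀ x, br x x = 0
  jacobi : ∀ x y z, br (br x y) z + br (br y z) x + br (br z x) y = 0

structure IsCompletedLieCoalgebra {k L G : Type*} [Field k] [AddCommGroup L] [Module k L]
    (ℒ : G → Submodule k L) (δ : L →ₗ[k] CompletedTensor ℒ ℒ) : Prop where
  locallyFinite : LocallyFinite ℒ δ
  skew : ∀ x, δ x + flipHat ℒ (δ x) = 0
  coJacobi : ∀ x,
    assocHat ℒ (mapRightHat ℒ ℒ δ (δ x))
      - flipLeftHat ℒ (assocHat ℒ (mapRightHat ℒ ℒ δ (δ x)))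
      - mapLeftHat ℒ ℒ δ (δ x) = 0

/-- `(f ⊗̂ id + id ⊗̂ f) x` for a linear endomorphism `f`. -/
def actHat {k L G : Type*} [Field k] [AddCommGroup L] [Module k L] [DecidableEq G]
    (ℒ : G → Submodule k L) [DirectSum.Decomposition ℒ] (f : L →ₗ[k] L)
    (x : CompletedTensor ℒ ℒ) : CompletedTensor ℒ ℒ :=
  mapLeftHat ℒ ℒ (toPi ℒ ∘ₗ f) x + mapRightHat ℒ ℒ (toPi ℒ ∘ₗ f) x

structure IsCompletedLieBialgebra {k L G : Type*} [Field k] [AddCommGroup L] [Module k L]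
    [DecidableEq G] (ℒ : G → Submodule k L) [DirectSum.Decomposition ℒ]
    (br : L →ₗ[k] L →ₗ[k] L) (δ : L →ₗ[k] CompletedTensor ℒ ℒ) : Prop where
  lie : IsLieBracket br
  coalgebra : IsCompletedLieCoalgebra ℒ δ
  ad_locallyFinite : ∀ x, LocallyFinite ℒ (toPi ℒ ∘ₗ br x)
  compatible : ∀ x y, δ (br x y) = actHat ℒ (br x) (δ y) - actHat ℒ (br y) (δ x)

/-! ### Quadratic graded perm algebras and the coproduct induced by the form -/

/-- A `G`-graded perm algebra with finite-dimensional homogeneous components and a skew-symmetric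
nondegenerate invariant graded bilinear form. -/
structure IsQuadraticGradedPerm {k P G : Type*} [Field k] [AddCommGroup P] [Module k P]
    [AddCommGroup G] [DecidableEq G] (𝒬 : G → Submodule k P) [DirectSum.Decomposition 𝒬]
    (m : P →ₗ[k] P →ₗ[k] P) (κ : P →ₗ[k] P →ₗ[k] k) : Prop where
  perm : IsPerm m
  finiteDimensional : ∀ g, FiniteDimensional k (𝒬 g)
  mul_mem : ∀ i j, ∀ p ∈ 𝒬 i, ∀ q ∈ 𝒬 j, m p q ∈ 𝒬 (i + j)
  skew : ∀ p q, κ p q = -κ q p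
  nondegenerate : κ.Nondegenerate
  invariant : ∀ p q r, κ (m p q) r = κ p (m q r - m r q)
  graded : ∃ d : G, ∀ i j, i + j ≠ d → ∀ p ∈ 𝒬 i, ∀ q ∈ 𝒬 j, κ p q = 0

/-- The pairing `κ̃(∑ v_i ⊗ w_j, q ⊗ r) = ∑ κ(v_i, q) κ(w_j, r)`; for a graded form only finitely
many terms are nonzero. -/
def pairHat {k P G : Type*} [Field k] [AddCommGroup P] [Module k P] (𝒬 : G → Submodule k P)
    (κ : P →ₗ[k] P →ₗ[k] k) (x : CompletedTensor 𝒬 𝒬) (q r : P) : k :=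
  ∑ᶠ t : G × G, LinearMap.mul' k k
    (TensorProduct.map (κ.flip q ∘ₗ (𝒬 t.1).subtype) (κ.flip r ∘ₗ (𝒬 t.2).subtype) (x t))

/-- The equation `κ̃(Δ(p), q ⊗ r) = -κ(p, q · r)` defining the coproduct induced by `κ`. -/
def IsInducedCoproduct {k P G : Type*} [Field k] [AddCommGroup P] [Module k P]
    (𝒬 : G → Submodule k P) (m : P →ₗ[k] P →ₗ[k] P) (κ : P →ₗ[k] P →ₗ[k] k)
    (Δ : P →ₗ[k] CompletedTensor 𝒬 𝒬) : Prop :=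
  ∀ p q r, pairHat 𝒬 κ (Δ p) q r = -κ p (m q r)

/-! ### The structures on `A ⊗ P` -/

/-- The canonical map `A ⊗ 𝒬 g → A ⊗ P`. -/
abbrev tensorIncl {k P G : Type*} (A : Type*) [Field k] [AddCommGroup A] [Module k A]
    [AddCommGroup P] [Module k P] (𝒬 : G → Submodule k P) (g : G) :
    A ⊗[k] 𝒬 g →ₗ[k] A ⊗[k] P :=
  (𝒬 g).subtype.lTensor A

/-- The homogeneous component `A ⊗ 𝒬 g` of `A ⊗ P`. -/
def tensorGrading {k P G : Type*} (A : Type*) [Field k] [AddCommGroup A] [Module k A]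
    [AddCommGroup P] [Module k P] (𝒬 : G → Submodule k P) (g : G) : Submodule k (A ⊗[k] P) :=
  LinearMap.range (tensorIncl A 𝒬 g)

/-- The canonical map of `A ⊗ 𝒬 g` onto the homogeneous component of `A ⊗ P`. -/
def toTensorGrading {k P G : Type*} (A : Type*) [Field k] [AddCommGroup A] [Module k A]
    [AddCommGroup P] [Module k P] (𝒬 : G → Submodule k P) (g : G) :
    A ⊗[k] 𝒬 g →ₗ[k] tensorGrading A 𝒬 g :=
  (tensorIncl A 𝒬 g).rangeRestrict

instance tensorGradingDecomposition {k P G : Type*} (A : Type*) [Field k] [AddCommGroup A]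
    [Module k A] [AddCommGroup P] [Module k P] [DecidableEq G] (𝒬 : G → Submodule k P)
    [DirectSum.Decomposition 𝒬] : DirectSum.Decomposition (tensorGrading A 𝒬) := by
  refine DirectSum.Decomposition.ofLinearMap _
    (DirectSum.lmap (fun g => toTensorGrading A 𝒬 g)
      ∘ₗ (TensorProduct.directSumRight k k A (fun g => 𝒬 g)).toLinearMap
      ∘ₗ (DirectSum.decomposeLinearEquiv 𝒬).toLinearMap.lTensor A) ?_ ?_
  · refine TensorProduct.ext' fun a p => ?_
    obtain ⟨x, rfl⟩ := (DirectSum.decomposeLinearEquiv 𝒬).symm.surjective p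
    induction x using DirectSum.induction_on with
    | zero => simp
    | of g p =>
      simp only [LinearMap.comp_apply, LinearMap.lTensor_tmul, LinearEquiv.coe_coe,
        LinearEquiv.apply_symm_apply]
      rw [← DirectSum.lof_eq_of k, TensorProduct.directSumRight_tmul_lof, DirectSum.lmap_lof,
        DirectSum.coeLinearMap_lof]
      change a ⊗ₜ[k] (p : P) = a ⊗ₜ[k] (DirectSum.decompose 𝒬).symm (DirectSum.lof k G _ g p)
      rw [DirectSum.lof_eq_of, DirectSum.decompose_symm_of]
    | add x y hx hy => rw [map_add, TensorProduct.tmul_add, map_add, hx, hy, map_add]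
  · refine DirectSum.linearMap_ext k fun g => LinearMap.ext fun ⟨z, hz⟩ => ?_
    obtain ⟨y, rfl⟩ := hz
    simp only [LinearMap.comp_apply, DirectSum.coeLinearMap_lof, LinearMap.id_apply]
    change _ = DirectSum.lof k G (fun g => tensorGrading A 𝒬 g) g (toTensorGrading A 𝒬 g y)
    induction y using TensorProduct.induction_on with
    | zero => simp
    | tmul a p =>
      simp only [LinearMap.lTensor_tmul, LinearEquiv.coe_coe, Submodule.subtype_apply,
        DirectSum.decomposeLinearEquiv_apply, DirectSum.decompose_coe]
      rw [← DirectSum.lof_eq_of k, TensorProduct.directSumRight_tmul_lof, DirectSum.lmap_lof]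
    | add x y hx hy => simp only [map_add, hx, hy]

/-- The bracket `[a ⊗ p, b ⊗ q] = (a ⋄ b) ⊗ (p · q) - (b ⋄ a) ⊗ (q · p)` on `A ⊗ P`. -/
def inducedBracket {k A P : Type*} [Field k] [AddCommGroup A] [Module k A]
    [AddCommGroup P] [Module k P] (mA : A →ₗ[k] A →ₗ[k] A) (mP : P →ₗ[k] P →ₗ[k] P) :
    A ⊗[k] P →ₗ[k] A ⊗[k] P →ₗ[k] A ⊗[k] P :=
  TensorProduct.map₂ mA mP - (TensorProduct.map₂ mA mP).flip

/-- The product `(a ⊗ b) • ∑ p_i ⊗ q_j = ∑ (a ⊗ p_i) ⊗ (b ⊗ q_j)`. -/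
def bullet {k P G : Type*} (A : Type*) [Field k] [AddCommGroup A] [Module k A]
    [AddCommGroup P] [Module k P] (𝒬 : G → Submodule k P) :
    (A ⊗[k] A) ⊗[k] CompletedTensor 𝒬 𝒬
      →ₗ[k] CompletedTensor (tensorGrading A 𝒬) (tensorGrading A 𝒬) :=
  LinearMap.pi fun t =>
    TensorProduct.map (toTensorGrading A 𝒬 t.1) (toTensorGrading A 𝒬 t.2)
      ∘ₗ (TensorProduct.tensorTensorTensorComm k A A (𝒬 t.1) (𝒬 t.2)).toLinearMap
      ∘ₗ (LinearMap.proj t : CompletedTensor 𝒬 𝒬 →ₗ[k] 𝒬 t.1 ⊗[k] 𝒬 t.2).lTensor (A ⊗[k] A)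

/-- The cobracket `δ(a ⊗ p) = (id - σ̂)(Δ_A(a) • Δ_P(p))` on `A ⊗ P`. -/
def inducedCobracket {k A P G : Type*} [Field k] [AddCommGroup A] [Module k A]
    [AddCommGroup P] [Module k P] (𝒬 : G → Submodule k P)
    (ΔA : A →ₗ[k] A ⊗[k] A) (ΔP : P →ₗ[k] CompletedTensor 𝒬 𝒬) :
    A ⊗[k] P →ₗ[k] CompletedTensor (tensorGrading A 𝒬) (tensorGrading A 𝒬) :=
  (LinearMap.id - flipHat (tensorGrading A 𝒬)) ∘ₗ bullet A 𝒬 ∘ₗ TensorProduct.map ΔA ΔP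

/-! ### The perm algebra of Laurent vector fields in two variables -/

/-- The index `((m, n), s)` stands for the monomial vector field `x₁^m x₂^n ∂_{s+1}`. -/
abbrev LaurentIndex : Type := (ℤ × ℤ) × Fin 2

/-- The space of `f₁ ∂₁ + f₂ ∂₂` with `f₁, f₂ ∈ k[x₁^±, x₂^±]`, written in its basis of monomial
vector fields. -/
abbrev LaurentField (k : Type*) [Field k] : Type _ := LaurentIndex →₀ k

/-- The exponent of the variable `x_{s+1}`. -/
def unitExp (s : Fin 2) : ℤ × ℤ := if s = 0 then (1, 0) else (0, 1)

/-- `(x^i ∂_s) · (x^j ∂_t) = x^{i + j + e_s} ∂_t`. -/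
def laurentMul (k : Type*) [Field k] :
    LaurentField k →ₗ[k] LaurentField k →ₗ[k] LaurentField k :=
  Finsupp.linearCombination k fun b : LaurentIndex =>
    Finsupp.linearCombination k fun c : LaurentIndex =>
      Finsupp.single (b.1 + c.1 + unitExp b.2, c.2) (1 : k)

/-- `κ(x^i ∂₂, x^j ∂₁) = -κ(x^j ∂₁, x^i ∂₂) = δ_{i + j, 0}`, and `κ(x^i ∂_s, x^j ∂_s) = 0`. -/
def laurentForm (k : Type*) [Field k] : LaurentField k →ₗ[k] LaurentField k →ₗ[k] k :=
  Finsupp.linearCombination k fun b : LaurentIndex =>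
    Finsupp.linearCombination k fun c : LaurentIndex =>
      if b.1 + c.1 = 0 then
        (if b.2 = 1 ∧ c.2 = 0 then 1 else if b.2 = 0 ∧ c.2 = 1 then -1 else (0 : k))
      else 0

/-- The bidegree of `x^i ∂_s` is `i + e_s`; the sum of its two entries is the total degree `|i| + 1`,
and each bidegree has exactly two monomial vector fields. -/
def laurentDeg (b : LaurentIndex) : ℤ × ℤ := b.1 + unitExp b.2

/-- The grading of the Laurent vector fields by bidegree. -/
def laurentGrading (k : Type*) [Field k] (g : ℤ × ℤ) : Submodule k (LaurentField k) :=
  Finsupp.supported k k {b | laurentDeg b = g}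

instance laurentGradingDecomposition (k : Type*) [Field k] :
    DirectSum.Decomposition (laurentGrading k) := by
  refine DirectSum.Decomposition.ofLinearMap _
    (Finsupp.linearCombination k fun b : LaurentIndex =>
      DirectSum.lof k (ℤ × ℤ) (fun g => laurentGrading k g) (laurentDeg b)
        ⟨Finsupp.single b 1, Finsupp.single_mem_supported k (1 : k) rfl⟩) ?_ ?_
  · refine Finsupp.lhom_ext fun b c => ?_
    simp
  · refine DirectSum.linearMap_ext k fun g => LinearMap.ext fun ⟨z, hz⟩ => ?_
    simp only [LinearMap.comp_apply, DirectSum.coeLinearMap_lof, LinearMap.id_apply]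
    have h : ∀ b ∈ z.support,
        z b • DirectSum.lof k (ℤ × ℤ) (fun g => laurentGrading k g) (laurentDeg b)
            ⟨Finsupp.single b 1, Finsupp.single_mem_supported k (1 : k) rfl⟩
          = DirectSum.lof k (ℤ × ℤ) (fun g => laurentGrading k g) g
            (if hb : laurentDeg b = g then
              z b • ⟨Finsupp.single b 1, Finsupp.single_mem_supported k (1 : k) hb⟩ else 0) := by
      intro b hb
      have hg : laurentDeg b = g := hz hb
      subst hg
      simp
    rw [Finsupp.linearCombination_apply, Finsupp.sum, Finset.sum_congr rfl h, ← map_sum]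
    congr 1
    apply Subtype.ext
    rw [AddSubmonoidClass.coe_finsetSum]
    refine Eq.trans ?_ (Finsupp.sum_single z)
    rw [Finsupp.sum]
    refine Finset.sum_congr rfl fun b hb => ?_
    have hg : laurentDeg b = g := hz hb
    simp [hg]

end

end AffineBialgebra

open AffineBialgebra

set_option linter.unusedSectionVars false

/-! Everything is tested by contracting tensor factors with `κ` against homogeneous elements of `P`.
The components of `P` are finite-dimensional and `κ` is graded and nondegenerate, so `𝒬 g` and `𝒬 (d
- g)` carry dual bases (`exists_dual_family`). These determine `ΔP` explicitly, and they show that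
contractions detect every component of a twofold or threefold completed tensor, whatever the
dimension of `A` (`eq_of_contr₂_eq`, `eq_of_contr₃_eq`). Gradedness also leaves a single term in
each sum defining `f ⊗̂ id` or `id ⊗̂ f` (`map_mapLeftHat`, `map_mapRightHat`).

Write `x_q` for the contraction of `x` with `q`. Contracting `δ(x)` with `q ⊗ r` gives
`σΔ_A(x_{r·q}) - Δ_A(x_{q·r})` (`contr₂_inducedCobracket`). In a perm algebra a product of three
given elements depends only on which of them comes last, and left multiplications are self-adjoint
for `κ`. Hence each axiom for `L` collapses to three terms, one per choice of last factor, each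
built from a defect of the corresponding axiom for `A`: pre-Lie defects for Jacobi (`jacobi_tmul`),
permuted co-pre-Lie defects for co-Jacobi (`contr₃_coJacobi`), and the failures of the symmetries of
`ζ` for the cocycle condition (`contr₂_compatible`). For a pre-Lie bialgebra all of them vanish.

Conversely, for Laurent vector fields a triple product of `∂₁`, `∂₂` pairs nontrivially with
`x₂⁻²∂₂` only when it is `∂₂·(∂₂·∂₁)` (`laurentForm_mul_mul`). The position of the single `∂₁`
selects one of the three terms, so each defect vanishes separately. -/

namespace AffineBialgebra

noncomputable section

/-! ### Separating families of linear maps -/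

/-- A set `S` of linear maps `M → B` is separating if the identity of `M` is a linear combination
of maps factoring through the members of `S`. -/
def Separates {k M B : Type*} [Field k] [AddCommGroup M] [Module k M] [AddCommGroup B] [Module k B]
    (S : Set (M →ₗ[k] B)) : Prop :=
  LinearMap.id ∈ Submodule.span k {φ : M →ₗ[k] M | ∃ f ∈ S, ∃ g : B →ₗ[k] M, φ = g ∘ₗ f}

theorem Separates.eq_zero {k M B : Type*} [Field k] [AddCommGroup M] [Module k M]
    [AddCommGroup B] [Module k B] {S : Set (M →ₗ[k] B)} (hS : Separates S) {x : M}
    (hx : ∀ f ∈ S, f x = 0) : x = 0 := by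
  have key : ∀ φ ∈ Submodule.span k {φ : M →ₗ[k] M | ∃ f ∈ S, ∃ g : B →ₗ[k] M, φ = g ∘ₗ f},
      φ x = 0 := by
    intro φ hφ
    induction hφ using Submodule.span_induction with
    | mem φ h =>
      obtain ⟨f, hf, g, rfl⟩ := h
      simp [hx f hf]
    | zero => simp
    | add f g _ _ hf hg => simp [hf, hg]
    | smul c f _ hf => simp [hf]
  exact key _ hS

theorem Separates.eq {k M B : Type*} [Field k] [AddCommGroup M] [Module k M]
    [AddCommGroup B] [Module k B] {S : Set (M →ₗ[k] B)} (hS : Separates S) {x y : M}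
    (h : ∀ f ∈ S, f x = f y) : x = y :=
  sub_eq_zero.1 (hS.eq_zero fun f hf => by rw [map_sub, h f hf, sub_self])

/-- If `id = ∑ gᵢ fᵢ` and `id = ∑ g'ⱼ f'ⱼ`, then `id ⊗ id = ∑ (gᵢ ⊗ g'ⱼ)(fᵢ ⊗ f'ⱼ)`. Phrasing
separation through a span makes this stability immediate, with no finiteness needed on the targets.
-/
theorem Separates.tensor {k M B N C : Type*} [Field k] [AddCommGroup M] [Module k M]
    [AddCommGroup B] [Module k B] [AddCommGroup N] [Module k N] [AddCommGroup C] [Module k C]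
    {S : Set (M →ₗ[k] B)} {T : Set (N →ₗ[k] C)} (hS : Separates S) (hT : Separates T) :
    Separates (Set.image2 (fun f g => TensorProduct.map f g) S T) := by
  have h := Submodule.apply_mem_map₂ (TensorProduct.mapBilinear (RingHom.id k) M N M N) hS hT
  rw [Submodule.map₂_span_span] at h
  have hid : TensorProduct.mapBilinear (RingHom.id k) M N M N LinearMap.id LinearMap.id
      = LinearMap.id := TensorProduct.map_id
  rw [hid] at h
  refine Submodule.span_mono ?_ h
  rintro _ ⟨_, ⟨f, hf, f', rfl⟩, _, ⟨g, hg, g', rfl⟩, rfl⟩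
  exact ⟨_, ⟨f, hf, g, hg, rfl⟩, TensorProduct.map f' g', TensorProduct.map_comp _ _ _ _⟩

theorem separates_of_sum_eq {k M B ι : Type*} [Field k] [AddCommGroup M] [Module k M]
    [AddCommGroup B] [Module k B] [Fintype ι] {S : Set (M →ₗ[k] B)} (f : ι → M →ₗ[k] B)
    (g : ι → B →ₗ[k] M) (hf : ∀ i, f i ∈ S) (h : ∀ x, ∑ i, g i (f i x) = x) : Separates S := by
  have hid : (LinearMap.id : M →ₗ[k] M) = ∑ i, g i ∘ₗ f i := by
    ext x
    simp [h x]
  rw [Separates, hid]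
  exact Submodule.sum_mem _ fun i _ => Submodule.subset_span ⟨f i, hf i, g i, rfl⟩

/-! ### Homogeneous dual bases -/

section Form

variable {k P G : Type*} [Field k] [AddCommGroup P] [Module k P] [AddCommGroup G] [DecidableEq G]
  {𝒬 : G → Submodule k P} [DirectSum.Decomposition 𝒬] {κ : P →ₗ[k] P →ₗ[k] k}

theorem homogeneous_induction (𝒬 : G → Submodule k P) [DirectSum.Decomposition 𝒬]
    {motive : P → Prop} (mem : ∀ i, ∀ q ∈ 𝒬 i, motive q)
    (add : ∀ x y, motive x → motive y → motive (x + y)) (p : P) : motive p :=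
  DirectSum.Decomposition.inductionOn 𝒬 (mem 0 0 (zero_mem _)) (fun q => mem _ q q.2)
    (fun x y => add x y) p

/-- `κ` pairs `𝒬 i` and `𝒬 j` trivially unless `i + j = d`. -/
def IsGradedForm (𝒬 : G → Submodule k P) (κ : P →ₗ[k] P →ₗ[k] k) (d : G) : Prop :=
  ∀ i j, i + j ≠ d → ∀ p ∈ 𝒬 i, ∀ q ∈ 𝒬 j, κ p q = 0

theorem IsGradedForm.apply_component {d : G} (hd : IsGradedForm 𝒬 κ d) {g : G} {p : P}
    (hp : p ∈ 𝒬 g) (q : P) : κ p (DirectSum.decompose 𝒬 q (d - g)) = κ p q := by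
  induction q using homogeneous_induction 𝒬 with
  | mem i q hq =>
    by_cases h : i = d - g
    · subst h
      rw [DirectSum.decompose_of_mem_same _ hq]
    · rw [DirectSum.decompose_of_mem_ne _ hq h, map_zero,
        hd g i (fun e => h (by rw [← e]; abel)) p hp q hq]
  | add x y hx hy => simp [DirectSum.decompose_add, hx, hy]

theorem IsGradedForm.component_apply {d : G} (hd : IsGradedForm 𝒬 κ d) {j : G} {q : P}
    (hq : q ∈ 𝒬 j) (p : P) : κ (DirectSum.decompose 𝒬 p (d - j)) q = κ p q := by
  refine IsGradedForm.apply_component (κ := κ.flip) (fun i j hij p hp q hq => ?_) hq p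
  exact hd j i (by rwa [add_comm]) q hq p hp

/-- Gradedness makes the restriction of `κ` to `𝒬 g × 𝒬 (d - g)` nondegenerate on both sides, hence
perfect in finite dimension; `b` is a basis and `c` its dual basis. The last clause recovers only
the part of `q` that `𝒬 g` can see. -/
theorem exists_dual_family {d : G} (hfin : ∀ g, FiniteDimensional k (𝒬 g))
    (hnd : κ.Nondegenerate) (hd : IsGradedForm 𝒬 κ d) (g : G) :
    ∃ (n : ℕ) (b : Fin n → 𝒬 g) (c : Fin n → 𝒬 (d - g)),
      (∀ p : 𝒬 g, ∑ i, κ p (c i) • b i = p) ∧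
      ∀ q : P, ∑ i, κ (b i) q • (c i : P) = DirectSum.decompose 𝒬 q (d - g) := by
  have := hfin
  let B : 𝒬 g →ₗ[k] 𝒬 (d - g) →ₗ[k] k := κ.domRestrict₁₂ (𝒬 g) (𝒬 (d - g))
  have hB : ∀ p q, B p q = κ p q := fun _ _ => rfl
  have h1 : Function.Injective B := by
    refine (injective_iff_map_eq_zero _).2 fun p hp => Subtype.ext (hnd.1 _ fun q => ?_)
    rw [← hd.apply_component p.2 q, ← hB, hp, LinearMap.zero_apply]
  have h2 : Function.Injective B.flip := by
    refine (injective_iff_map_eq_zero _).2 fun q hq => Subtype.ext (hnd.2 _ fun p => ?_)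
    have := hd.component_apply q.2 p
    have e : d - (d - g) = g := by abel
    rw [e] at this
    rw [← this, ← hB, ← LinearMap.flip_apply, hq, LinearMap.zero_apply]
  have hp : B.IsPerfPair := .of_injective h1 h2
  let b := Module.finBasis k (𝒬 g)
  choose c hc using fun i => hp.bijective_right.2 (b.coord i)
  have hc' : ∀ i (p : 𝒬 g), κ p (c i) = b.coord i p := fun i p => by
    rw [← hc, LinearMap.flip_apply, hB]
  refine ⟨_, b, c, fun p => ?_, fun q => ?_⟩
  · simp only [hc', Module.Basis.coord_apply]
    exact b.sum_repr p
  · have : ∑ i, κ (b i) q • c i = DirectSum.decompose 𝒬 q (d - g) := by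
      apply h2
      ext p
      rw [LinearMap.flip_apply, LinearMap.flip_apply, map_sum, hB p (DirectSum.decompose 𝒬 q (d - g)),
        hd.apply_component p.2]
      have hφ : (κ.flip q ∘ₗ (𝒬 g).subtype) p
          = ∑ i, b.repr p i • (κ.flip q ∘ₗ (𝒬 g).subtype) (b i) := by
        conv_lhs => rw [← b.sum_repr p]
        simp only [map_sum, map_smul]
      simpa [hB, hc', mul_comm] using hφ.symm
    rw [← this]
    simp

/-! ### Existence and uniqueness of the induced coproduct -/

/-- The pairing of an element of `𝒬 g ⊗ 𝒬 h` with `q ⊗ r`. -/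
def pairComponent (κ : P →ₗ[k] P →ₗ[k] k) (q r : P) (g h : G) : 𝒬 g ⊗[k] 𝒬 h →ₗ[k] k :=
  LinearMap.mul' k k ∘ₗ
    TensorProduct.map (κ.flip q ∘ₗ (𝒬 g).subtype) (κ.flip r ∘ₗ (𝒬 h).subtype)

theorem pairComponent_tmul (q r : P) (g h : G) (v : 𝒬 g) (w : 𝒬 h) :
    pairComponent κ q r g h (v ⊗ₜ w) = κ v q * κ w r := by
  simp [pairComponent]

theorem pairComponent_eq_zero {d : G} (hd : IsGradedForm 𝒬 κ d) {i j : G} {q r : P}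
    (hq : q ∈ 𝒬 i) (hr : r ∈ 𝒬 j) {g h : G} (hg : g + i = d) (hh : h + j = d)
    {t : G × G} (ht : t ≠ (g, h))
    (y : 𝒬 t.1 ⊗[k] 𝒬 t.2) : pairComponent κ q r t.1 t.2 y = 0 := by
  induction y using TensorProduct.induction_on with
  | zero => simp
  | add x y hx hy => rw [map_add, hx, hy, add_zero]
  | tmul v w =>
    rw [pairComponent_tmul]
    by_cases h : t.1 = g
    · have h' : t.2 + j ≠ d := fun e => ht (Prod.ext h (add_right_cancel (e.trans hh.symm)))
      rw [hd _ _ h' w w.2 r hr, mul_zero]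
    · have h' : t.1 + i ≠ d := fun e => h (add_right_cancel (e.trans hg.symm))
      rw [hd _ _ h' v v.2 q hq, zero_mul]

/-- Homogeneous `q` and `r` pair nontrivially only with the complementary degrees, so the sum
defining `pairHat` has one term. -/
theorem pairHat_of_mem {d : G} (hd : IsGradedForm 𝒬 κ d) {i j : G} {q r : P}
    (hq : q ∈ 𝒬 i) (hr : r ∈ 𝒬 j) {g h : G} (hg : g + i = d) (hh : h + j = d)
    (x : CompletedTensor 𝒬 𝒬) : pairHat 𝒬 κ x q r = pairComponent κ q r g h (x (g, h)) :=
  finsum_eq_single _ (g, h) fun _ ht => pairComponent_eq_zero hd hq hr hg hh ht _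

theorem eq_of_pairComponent_eq {d : G} (hfin : ∀ g, FiniteDimensional k (𝒬 g))
    (hnd : κ.Nondegenerate) (hd : IsGradedForm 𝒬 κ d) (g h : G) {x y : 𝒬 g ⊗[k] 𝒬 h}
    (hxy : ∀ q ∈ 𝒬 (d - g), ∀ r ∈ 𝒬 (d - h),
      pairComponent κ q r g h x = pairComponent κ q r g h y) : x = y := by
  have hsep : ∀ g, Separates {f : 𝒬 g →ₗ[k] k | ∃ q ∈ 𝒬 (d - g), f = κ.flip q ∘ₗ (𝒬 g).subtype} := by
    intro g
    obtain ⟨n, b, c, hb, -⟩ := exists_dual_family hfin hnd hd g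
    exact separates_of_sum_eq (fun i => κ.flip (c i) ∘ₗ (𝒬 g).subtype)
      (fun i => LinearMap.toSpanSingleton k _ (b i)) (fun i => ⟨c i, (c i).2, rfl⟩) fun p => hb p
  refine ((hsep g).tensor (hsep h)).eq ?_
  rintro _ ⟨_, ⟨q, hq, rfl⟩, _, ⟨r, hr, rfl⟩, rfl⟩
  -- A tensor product of two functionals takes values in `k ⊗ k`, which multiplication identifies
  -- with `k`.
  have hinj : Function.Injective (LinearMap.mul' k k) := (TensorProduct.lid k k).injective
  exact hinj (hxy q hq r hr)

theorem finsum_component_eq (m : P →ₗ[k] P →ₗ[k] k) (q r : P) :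
    ∑ᶠ t : G × G, m (DirectSum.decompose 𝒬 q t.1) (DirectSum.decompose 𝒬 r t.2) = m q r := by
  classical
  rw [finsum_eq_sum_of_support_subset (s := (DirectSum.decompose 𝒬 q).support ×ˢ
    (DirectSum.decompose 𝒬 r).support), Finset.sum_product]
  · conv_rhs => rw [← DirectSum.sum_support_decompose 𝒬 q, ← DirectSum.sum_support_decompose 𝒬 r]
    simp only [map_sum, LinearMap.sum_apply]
    exact Finset.sum_comm
  · intro t ht
    simp only [Finset.coe_product, Set.mem_prod, Finset.mem_coe, DFinsupp.mem_support_iff]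
    refine ⟨fun e => ht ?_, fun e => ht ?_⟩ <;> simp [e]

theorem IsInducedCoproduct.unique {d : G} (hfin : ∀ g, FiniteDimensional k (𝒬 g))
    (hnd : κ.Nondegenerate) (hd : IsGradedForm 𝒬 κ d) {m : P →ₗ[k] P →ₗ[k] P}
    {Δ Δ' : P →ₗ[k] CompletedTensor 𝒬 𝒬} (h : IsInducedCoproduct 𝒬 m κ Δ)
    (h' : IsInducedCoproduct 𝒬 m κ Δ') : Δ = Δ' := by
  refine LinearMap.ext fun p => funext fun t => eq_of_pairComponent_eq hfin hnd hd t.1 t.2 ?_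
  intro q hq r hr
  rw [← pairHat_of_mem hd hq hr (add_sub_cancel _ _) (add_sub_cancel _ _),
    ← pairHat_of_mem hd hq hr (add_sub_cancel _ _) (add_sub_cancel _ _), h, h']

/-- With dual bases, the component in `𝒬 g ⊗ 𝒬 h` is `-∑ κ(p, cᵢ·cⱼ) bᵢ ⊗ bⱼ`. Its pairing with `q ⊗
r` is `-κ(p, q'·r')`, where `q'`, `r'` are the parts of degrees `d - g`, `d - h`; summing over all
degrees gives `-κ(p, q·r)`. -/
theorem exists_inducedCoproduct {d : G} (hfin : ∀ g, FiniteDimensional k (𝒬 g))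
    (hnd : κ.Nondegenerate) (hd : IsGradedForm 𝒬 κ d) (m : P →ₗ[k] P →ₗ[k] P) :
    ∃ Δ : P →ₗ[k] CompletedTensor 𝒬 𝒬, IsInducedCoproduct 𝒬 m κ Δ := by
  choose n b c hb hc using exists_dual_family hfin hnd hd
  refine ⟨LinearMap.pi fun t => ∑ i, ∑ j,
    LinearMap.toSpanSingleton k _ (b t.1 i ⊗ₜ[k] b t.2 j) ∘ₗ (-(κ.flip (m (c t.1 i) (c t.2 j)))),
    fun p q r => ?_⟩
  let F : P →ₗ[k] P →ₗ[k] k := -(m.compr₂ (κ p))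
  have hF : ∀ q r, F q r = -κ p (m q r) := fun _ _ => rfl
  rw [← hF, ← finsum_component_eq (𝒬 := 𝒬) F q r,
    -- Reindex by `g ↦ d - g`, since degree `g` of the coproduct meets degree `d - g` of the test
    -- element.
    ← finsum_comp_equiv ((Equiv.subLeft d).prodCongr (Equiv.subLeft d))]
  refine finsum_congr fun t => ?_
  change pairComponent κ q r t.1 t.2 _ = F (DirectSum.decompose 𝒬 q (d - t.1))
    (DirectSum.decompose 𝒬 r (d - t.2))
  rw [← hc, ← hc]
  change pairComponent κ q r t.1 t.2 ((∑ i, ∑ j,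
    LinearMap.toSpanSingleton k _ (b t.1 i ⊗ₜ[k] b t.2 j) ∘ₗ
      (-(κ.flip (m (c t.1 i) (c t.2 j))))) p) = _
  simp only [LinearMap.sum_apply, map_sum, LinearMap.comp_apply,
    LinearMap.toSpanSingleton_apply, map_smul, pairComponent_tmul, LinearMap.neg_apply,
    LinearMap.flip_apply, hF, smul_eq_mul, LinearMap.smul_apply]
  simp only [Finset.mul_sum]
  rw [Finset.sum_comm]
  refine Finset.sum_congr rfl fun j _ => Finset.sum_congr rfl fun i _ => ?_
  ring

end Form

/-! ### Componentwise extensions of locally finite maps -/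

section Hat

variable {k V W G T : Type*} {E : T → Type*} [Field k] [AddCommGroup V] [Module k V]
  [AddCommGroup W] [Module k W] [∀ t, AddCommGroup (E t)] [∀ t, Module k (E t)]
  {𝒱 : G → Submodule k V} {𝒲 : G → Submodule k W}

theorem LocallyFinite.add {f f' : V →ₗ[k] ∀ t, E t} (hf : LocallyFinite 𝒱 f)
    (hf' : LocallyFinite 𝒱 f') : LocallyFinite 𝒱 (f + f') := by
  refine fun t => ((hf t).union (hf' t)).subset ?_
  rintro g ⟨v, hv, hne⟩
  by_cases h : f v t = 0
  · exact Or.inr ⟨v, hv, fun h' => hne (by simp [h, h'])⟩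
  · exact Or.inl ⟨v, hv, h⟩

theorem LocallyFinite.finite_support_left {f : V →ₗ[k] ∀ t, E t} (hf : LocallyFinite 𝒱 f)
    (x : CompletedTensor 𝒱 𝒲) (s : T × G) :
    (Function.support fun g : G =>
      ((LinearMap.proj s.1 ∘ₗ f) ∘ₗ (𝒱 g).subtype).rTensor (𝒲 s.2) (x (g, s.2))).Finite := by
  refine (hf s.1).subset fun g hg => ?_
  by_contra hne
  refine hg ?_
  have h0 : (LinearMap.proj s.1 ∘ₗ f) ∘ₗ (𝒱 g).subtype = 0 :=
    LinearMap.ext fun v => by_contra fun h => hne ⟨v, v.2, h⟩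
  simp only [h0, LinearMap.rTensor_zero, LinearMap.zero_apply]

theorem LocallyFinite.finite_support_right {f : W →ₗ[k] ∀ t, E t} (hf : LocallyFinite 𝒲 f)
    (x : CompletedTensor 𝒱 𝒲) (s : G × T) :
    (Function.support fun g : G =>
      ((LinearMap.proj s.2 ∘ₗ f) ∘ₗ (𝒲 g).subtype).lTensor (𝒱 s.1) (x (s.1, g))).Finite := by
  refine (hf s.2).subset fun g hg => ?_
  by_contra hne
  refine hg ?_
  have h0 : (LinearMap.proj s.2 ∘ₗ f) ∘ₗ (𝒲 g).subtype = 0 :=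
    LinearMap.ext fun v => by_contra fun h => hne ⟨v, v.2, h⟩
  simp only [h0, LinearMap.lTensor_zero, LinearMap.zero_apply]

theorem mapLeftHat_add {f : V →ₗ[k] ∀ t, E t} (hf : LocallyFinite 𝒱 f)
    (x y : CompletedTensor 𝒱 𝒲) :
    mapLeftHat 𝒱 𝒲 f (x + y) = mapLeftHat 𝒱 𝒲 f x + mapLeftHat 𝒱 𝒲 f y := by
  funext s
  simp only [mapLeftHat, Pi.add_apply, map_add]
  exact finsum_add_distrib (hf.finite_support_left x s) (hf.finite_support_left y s)

theorem mapRightHat_add {f : W →ₗ[k] ∀ t, E t} (hf : LocallyFinite 𝒲 f)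
    (x y : CompletedTensor 𝒱 𝒲) :
    mapRightHat 𝒱 𝒲 f (x + y) = mapRightHat 𝒱 𝒲 f x + mapRightHat 𝒱 𝒲 f y := by
  funext s
  simp only [mapRightHat, Pi.add_apply, map_add]
  exact finsum_add_distrib (hf.finite_support_right x s) (hf.finite_support_right y s)

theorem add_mapLeftHat {f f' : V →ₗ[k] ∀ t, E t} (hf : LocallyFinite 𝒱 f)
    (hf' : LocallyFinite 𝒱 f') (x : CompletedTensor 𝒱 𝒲) :
    mapLeftHat 𝒱 𝒲 (f + f') x = mapLeftHat 𝒱 𝒲 f x + mapLeftHat 𝒱 𝒲 f' x := by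
  funext s
  simp only [mapLeftHat, Pi.add_apply, LinearMap.comp_add, LinearMap.add_comp,
    LinearMap.rTensor_add, LinearMap.add_apply]
  exact finsum_add_distrib (hf.finite_support_left x s) (hf'.finite_support_left x s)

theorem add_mapRightHat {f f' : W →ₗ[k] ∀ t, E t} (hf : LocallyFinite 𝒲 f)
    (hf' : LocallyFinite 𝒲 f') (x : CompletedTensor 𝒱 𝒲) :
    mapRightHat 𝒱 𝒲 (f + f') x = mapRightHat 𝒱 𝒲 f x + mapRightHat 𝒱 𝒲 f' x := by
  funext s
  simp only [mapRightHat, Pi.add_apply, LinearMap.comp_add, LinearMap.add_comp,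
    LinearMap.lTensor_add, LinearMap.add_apply]
  exact finsum_add_distrib (hf.finite_support_right x s) (hf'.finite_support_right x s)

/-- Local finiteness lets `φ ⊗ ψ` pass through the sum; then only degree `g₀` survives because `χ`
vanishes elsewhere. Below, `φ` is a contraction and `g₀` is the one degree it can see through `f`.
-/
theorem map_mapLeftHat {B C : Type*} [AddCommGroup B] [Module k B] [AddCommGroup C] [Module k C]
    {f : V →ₗ[k] ∀ t, E t} (hf : LocallyFinite 𝒱 f) (s : T × G) (φ : E s.1 →ₗ[k] B)
    (ψ : 𝒲 s.2 →ₗ[k] C) (χ : V →ₗ[k] B) (hχ : ∀ v, φ (f v s.1) = χ v) (g₀ : G)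
    (h₀ : ∀ g ≠ g₀, ∀ v ∈ 𝒱 g, χ v = 0) (x : CompletedTensor 𝒱 𝒲) :
    TensorProduct.map φ ψ (mapLeftHat 𝒱 𝒲 f x s)
      = TensorProduct.map (χ ∘ₗ (𝒱 g₀).subtype) ψ (x (g₀, s.2)) := by
  have hterm : ∀ g, TensorProduct.map φ ψ
      (((LinearMap.proj s.1 ∘ₗ f) ∘ₗ (𝒱 g).subtype).rTensor (𝒲 s.2) (x (g, s.2)))
      = TensorProduct.map (χ ∘ₗ (𝒱 g).subtype) ψ (x (g, s.2)) := by
    intro g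
    have hc : φ ∘ₗ (LinearMap.proj s.1 ∘ₗ f) ∘ₗ (𝒱 g).subtype = χ ∘ₗ (𝒱 g).subtype :=
      LinearMap.ext fun v => hχ v
    rw [LinearMap.rTensor, ← LinearMap.comp_apply, ← TensorProduct.map_comp, hc,
      LinearMap.comp_id]
  have hsum := (TensorProduct.map φ ψ).toAddMonoidHom.map_finsum (hf.finite_support_left x s)
  refine (hsum.trans (finsum_congr hterm)).trans (finsum_eq_single _ g₀ fun g hg => ?_)
  have h0 : χ ∘ₗ (𝒱 g).subtype = 0 := LinearMap.ext fun v => h₀ g hg v v.2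
  rw [h0, TensorProduct.map_zero_left, LinearMap.zero_apply]

theorem map_mapRightHat {B C : Type*} [AddCommGroup B] [Module k B] [AddCommGroup C] [Module k C]
    {f : W →ₗ[k] ∀ t, E t} (hf : LocallyFinite 𝒲 f) (s : G × T) (φ : 𝒱 s.1 →ₗ[k] B)
    (ψ : E s.2 →ₗ[k] C) (χ : W →ₗ[k] C) (hχ : ∀ v, ψ (f v s.2) = χ v) (g₀ : G)
    (h₀ : ∀ g ≠ g₀, ∀ v ∈ 𝒲 g, χ v = 0) (x : CompletedTensor 𝒱 𝒲) :
    TensorProduct.map φ ψ (mapRightHat 𝒱 𝒲 f x s)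
      = TensorProduct.map φ (χ ∘ₗ (𝒲 g₀).subtype) (x (s.1, g₀)) := by
  have hterm : ∀ g, TensorProduct.map φ ψ
      (((LinearMap.proj s.2 ∘ₗ f) ∘ₗ (𝒲 g).subtype).lTensor (𝒱 s.1) (x (s.1, g)))
      = TensorProduct.map φ (χ ∘ₗ (𝒲 g).subtype) (x (s.1, g)) := by
    intro g
    have hc : ψ ∘ₗ (LinearMap.proj s.2 ∘ₗ f) ∘ₗ (𝒲 g).subtype = χ ∘ₗ (𝒲 g).subtype :=
      LinearMap.ext fun v => hχ v
    rw [LinearMap.lTensor, ← LinearMap.comp_apply, ← TensorProduct.map_comp, hc,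
      LinearMap.comp_id]
  have hsum := (TensorProduct.map φ ψ).toAddMonoidHom.map_finsum (hf.finite_support_right x s)
  refine (hsum.trans (finsum_congr hterm)).trans (finsum_eq_single _ g₀ fun g hg => ?_)
  have h0 : χ ∘ₗ (𝒲 g).subtype = 0 := LinearMap.ext fun v => h₀ g hg v v.2
  rw [h0, TensorProduct.map_zero_right, LinearMap.zero_apply]

end Hat

/-! ### Contraction with the form -/

section Contraction

variable {k A P G : Type*} [Field k] [AddCommGroup A] [Module k A] [AddCommGroup P] [Module k P]
  [AddCommGroup G] [DecidableEq G] {𝒬 : G → Submodule k P} [DirectSum.Decomposition 𝒬]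
  {κ : P →ₗ[k] P →ₗ[k] k}

/-- The contraction `a ⊗ p ↦ κ(p, q) a`. -/
def contr (A : Type*) [AddCommGroup A] [Module k A] (κ : P →ₗ[k] P →ₗ[k] k) (q : P) :
    A ⊗[k] P →ₗ[k] A :=
  (TensorProduct.rid k A).toLinearMap ∘ₗ (κ.flip q).lTensor A

theorem contr_tmul (q : P) (a : A) (p : P) : contr A κ q (a ⊗ₜ p) = κ p q • a := by
  simp [contr]

theorem tensor_homogeneous_induction (𝒬 : G → Submodule k P) [DirectSum.Decomposition 𝒬]
    {motive : A ⊗[k] P → Prop} (tmul : ∀ a i, ∀ q ∈ 𝒬 i, motive (a ⊗ₜ q))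
    (add : ∀ x y, motive x → motive y → motive (x + y)) (x : A ⊗[k] P) : motive x := by
  induction x using TensorProduct.induction_on with
  | zero => simpa using tmul 0 0 0 (zero_mem _)
  | add x y hx hy => exact add x y hx hy
  | tmul a p =>
    induction p using homogeneous_induction 𝒬 with
    | mem i q hq => exact tmul a i q hq
    | add x y hx hy =>
      rw [TensorProduct.tmul_add]
      exact add _ _ hx hy

theorem tmul_mem_tensorGrading (a : A) {g : G} {p : P} (hp : p ∈ 𝒬 g) :
    a ⊗ₜ[k] p ∈ tensorGrading A 𝒬 g :=
  ⟨a ⊗ₜ ⟨p, hp⟩, rfl⟩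

theorem tensorGrading_induction {g : G} {motive : A ⊗[k] P → Prop}
    (tmul : ∀ a, ∀ p ∈ 𝒬 g, motive (a ⊗ₜ p))
    (add : ∀ x y, motive x → motive y → motive (x + y)) {x : A ⊗[k] P}
    (hx : x ∈ tensorGrading A 𝒬 g) : motive x := by
  obtain ⟨y, rfl⟩ := hx
  induction y using TensorProduct.induction_on with
  | zero => simpa using tmul 0 0 (zero_mem _)
  | add x y hx hy =>
    rw [map_add]
    exact add _ _ hx hy
  | tmul a p => exact tmul a p p.2

theorem contr_eq_zero {d : G} (hd : IsGradedForm 𝒬 κ d) {g i : G} (h : g + i ≠ d) {q : P}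
    (hq : q ∈ 𝒬 i) {x : A ⊗[k] P} (hx : x ∈ tensorGrading A 𝒬 g) : contr A κ q x = 0 := by
  refine tensorGrading_induction (motive := fun x => contr A κ q x = 0) (fun a p hp => ?_)
    (fun x y hx hy => ?_) hx
  · rw [contr_tmul, hd g i h p hp q hq, zero_smul]
  · rw [map_add, hx, hy, add_zero]

theorem contr_component {d : G} (hd : IsGradedForm 𝒬 κ d) {g i : G} (h : g + i = d) {q : P}
    (hq : q ∈ 𝒬 i) (x : A ⊗[k] P) :
    contr A κ q (DirectSum.decompose (tensorGrading A 𝒬) x g) = contr A κ q x := by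
  induction x using homogeneous_induction (tensorGrading A 𝒬) with
  | mem j x hx =>
    by_cases hj : j = g
    · subst hj
      rw [DirectSum.decompose_of_mem_same _ hx]
    · rw [DirectSum.decompose_of_mem_ne _ hx hj, map_zero,
        contr_eq_zero hd (fun e => hj (add_right_cancel (e.trans h.symm))) hq hx]
  | add x y hx hy => simp [DirectSum.decompose_add, hx, hy]

/-- The restriction of `contr` to a homogeneous component. -/
def contrOn (A : Type*) [AddCommGroup A] [Module k A] (κ : P →ₗ[k] P →ₗ[k] k) (q : P) (g : G) :
    tensorGrading A 𝒬 g →ₗ[k] A :=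
  contr A κ q ∘ₗ (tensorGrading A 𝒬 g).subtype

/-- With dual bases, an element `y` of `A ⊗ 𝒬 g` equals the sum of its contractions with the `cᵢ`,
each tensored with `bᵢ`. -/
theorem separates_contrOn {d : G} (hfin : ∀ g, FiniteDimensional k (𝒬 g))
    (hnd : κ.Nondegenerate) (hd : IsGradedForm 𝒬 κ d) (g : G) :
    Separates {f : tensorGrading A 𝒬 g →ₗ[k] A | ∃ q ∈ 𝒬 (d - g), f = contrOn A κ q g} := by
  obtain ⟨n, b, c, hb, -⟩ := exists_dual_family hfin hnd hd g
  refine separates_of_sum_eq (fun i => contrOn A κ (c i) g)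
    (fun i => toTensorGrading A 𝒬 g ∘ₗ (TensorProduct.mk k A (𝒬 g)).flip (b i))
    (fun i => ⟨c i, (c i).2, rfl⟩) ?_
  rintro ⟨x, hx⟩
  obtain ⟨y, rfl⟩ := hx
  change ∑ i, toTensorGrading A 𝒬 g (contr A κ (c i) (tensorIncl A 𝒬 g y) ⊗ₜ[k] b i)
    = toTensorGrading A 𝒬 g y
  rw [← map_sum]
  congr 1
  induction y using TensorProduct.induction_on with
  | zero => simp
  | add x y hx hy => simp only [map_add, TensorProduct.add_tmul, Finset.sum_add_distrib, hx, hy]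
  | tmul a p =>
    simp only [LinearMap.lTensor_tmul, Submodule.subtype_apply, contr_tmul, TensorProduct.smul_tmul]
    rw [← TensorProduct.tmul_sum, hb]

/-- The contraction of both factors of a twofold tensor. -/
def contr₂ (A : Type*) [AddCommGroup A] [Module k A] (κ : P →ₗ[k] P →ₗ[k] k) (q r : P) (g h : G) :
    tensorGrading A 𝒬 g ⊗[k] tensorGrading A 𝒬 h →ₗ[k] A ⊗[k] A :=
  TensorProduct.map (contrOn A κ q g) (contrOn A κ r h)

/-- The contraction of all factors of a threefold tensor. -/
def contr₃ (A : Type*) [AddCommGroup A] [Module k A] (κ : P →ₗ[k] P →ₗ[k] k) (q r s : P)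
    (g h l : G) :
    (tensorGrading A 𝒬 g ⊗[k] tensorGrading A 𝒬 h) ⊗[k] tensorGrading A 𝒬 l
      →ₗ[k] (A ⊗[k] A) ⊗[k] A :=
  TensorProduct.map (contr₂ A κ q r g h) (contrOn A κ s l)

theorem eq_of_contr₂_eq {d : G} (hfin : ∀ g, FiniteDimensional k (𝒬 g))
    (hnd : κ.Nondegenerate) (hd : IsGradedForm 𝒬 κ d) {g h : G}
    {x y : tensorGrading A 𝒬 g ⊗[k] tensorGrading A 𝒬 h}
    (hxy : ∀ q ∈ 𝒬 (d - g), ∀ r ∈ 𝒬 (d - h), contr₂ A κ q r g h x = contr₂ A κ q r g h y) :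
    x = y := by
  refine ((separates_contrOn hfin hnd hd g).tensor (separates_contrOn hfin hnd hd h)).eq ?_
  rintro _ ⟨_, ⟨q, hq, rfl⟩, _, ⟨r, hr, rfl⟩, rfl⟩
  exact hxy q hq r hr

theorem eq_of_contr₃_eq {d : G} (hfin : ∀ g, FiniteDimensional k (𝒬 g))
    (hnd : κ.Nondegenerate) (hd : IsGradedForm 𝒬 κ d) {g h l : G}
    {x y : (tensorGrading A 𝒬 g ⊗[k] tensorGrading A 𝒬 h) ⊗[k] tensorGrading A 𝒬 l}
    (hxy : ∀ q ∈ 𝒬 (d - g), ∀ r ∈ 𝒬 (d - h), ∀ s ∈ 𝒬 (d - l),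
      contr₃ A κ q r s g h l x = contr₃ A κ q r s g h l y) : x = y := by
  refine (((separates_contrOn hfin hnd hd g).tensor (separates_contrOn hfin hnd hd h)).tensor
    (separates_contrOn hfin hnd hd l)).eq ?_
  rintro _ ⟨_, ⟨_, ⟨q, hq, rfl⟩, _, ⟨r, hr, rfl⟩, rfl⟩, _, ⟨s, hs, rfl⟩, rfl⟩
  exact hxy q hq r hr s hs

theorem contr₂_flipHat (q r : P) (g h : G)
    (x : CompletedTensor (tensorGrading A 𝒬) (tensorGrading A 𝒬)) :
    contr₂ A κ q r g h (flipHat (tensorGrading A 𝒬) x (g, h))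
      = TensorProduct.comm k A A (contr₂ A κ r q h g (x (h, g))) :=
  TensorProduct.map_comm _ _ _

theorem contr₂_bullet (q r : P) (g h : G) (w : A ⊗[k] A) (y : CompletedTensor 𝒬 𝒬) :
    contr₂ A κ q r g h (bullet A 𝒬 (w ⊗ₜ y) (g, h)) = pairComponent κ q r g h (y (g, h)) • w := by
  change contr₂ A κ q r g h (TensorProduct.map (toTensorGrading A 𝒬 g) (toTensorGrading A 𝒬 h)
    (TensorProduct.tensorTensorTensorComm k A A (𝒬 g) (𝒬 h) (w ⊗ₜ[k] y (g, h)))) = _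
  generalize y (g, h) = z
  induction z using TensorProduct.induction_on with
  | zero => simp
  | add x y hx hy => simp only [TensorProduct.tmul_add, map_add, hx, hy, add_smul]
  | tmul v v' =>
    induction w using TensorProduct.induction_on with
    | zero => simp
    | add x y hx hy => simp only [TensorProduct.add_tmul, map_add, hx, hy, smul_add]
    | tmul a b =>
      rw [TensorProduct.tensorTensorTensorComm_tmul, TensorProduct.map_tmul, contr₂,
        TensorProduct.map_tmul, pairComponent_tmul]
      change contr A κ q (a ⊗ₜ (v : P)) ⊗ₜ contr A κ r (b ⊗ₜ (v' : P)) = _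
      rw [contr_tmul, contr_tmul, TensorProduct.smul_tmul_smul]

/-- By definition of `ΔP`, contracting `Δ_A(a) • Δ_P(p)` with `q ⊗ r` gives `-κ(p, q·r) Δ_A(a)`; the
flipped summand exchanges `q` and `r`. The completed cobracket is thereby replaced by `ΔA` on `A`
itself. -/
theorem contr₂_inducedCobracket {d : G} (hd : IsGradedForm 𝒬 κ d) {m : P →ₗ[k] P →ₗ[k] P}
    {ΔP : P →ₗ[k] CompletedTensor 𝒬 𝒬} (hΔ : IsInducedCoproduct 𝒬 m κ ΔP)
    (ΔA : A →ₗ[k] A ⊗[k] A) {i j : G} {q r : P} (hq : q ∈ 𝒬 i) (hr : r ∈ 𝒬 j) {g h : G}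
    (hg : g + i = d) (hh : h + j = d) (x : A ⊗[k] P) :
    contr₂ A κ q r g h (inducedCobracket 𝒬 ΔA ΔP x (g, h))
      = TensorProduct.comm k A A (ΔA (contr A κ (m r q) x)) - ΔA (contr A κ (m q r) x) := by
  induction x using TensorProduct.induction_on with
  | zero => simp
  | add x y hx hy =>
    simp only [map_add, Pi.add_apply, hx, hy]
    abel
  | tmul a p =>
    change contr₂ A κ q r g h (bullet A 𝒬 (ΔA a ⊗ₜ ΔP p) (g, h)
      - flipHat (tensorGrading A 𝒬) (bullet A 𝒬 (ΔA a ⊗ₜ ΔP p)) (g, h)) = _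
    rw [map_sub, contr₂_flipHat, contr₂_bullet, contr₂_bullet, ← pairHat_of_mem hd hq hr hg hh,
      ← pairHat_of_mem hd hr hq hh hg, hΔ, hΔ, contr_tmul, contr_tmul]
    simp only [map_smul, neg_smul, map_neg]
    abel

end Contraction

/-! ### Permutations of threefold tensors -/

section Permutation

variable {k A : Type*} [Field k] [AddCommGroup A] [Module k A]

/-- The cyclic shift `(u ⊗ v) ⊗ w ↦ (w ⊗ u) ⊗ v`. -/
def cyclicShift (k A : Type*) [Field k] [AddCommGroup A] [Module k A] :
    (A ⊗[k] A) ⊗[k] A →ₗ[k] (A ⊗[k] A) ⊗[k] A :=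
  (TensorProduct.assoc k A A A).symm.toLinearMap ∘ₗ (TensorProduct.comm k (A ⊗[k] A) A).toLinearMap

/-- The transposition `(u ⊗ v) ⊗ w ↦ (u ⊗ w) ⊗ v`. -/
def swapRight (k A : Type*) [Field k] [AddCommGroup A] [Module k A] :
    (A ⊗[k] A) ⊗[k] A →ₗ[k] (A ⊗[k] A) ⊗[k] A :=
  (TensorProduct.assoc k A A A).symm.toLinearMap ∘ₗ
    (TensorProduct.comm k A A).toLinearMap.lTensor A ∘ₗ (TensorProduct.assoc k A A A).toLinearMap

/-- The transposition `(u ⊗ v) ⊗ w ↦ (v ⊗ u) ⊗ w`. -/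
def swapLeft (k A : Type*) [Field k] [AddCommGroup A] [Module k A] :
    (A ⊗[k] A) ⊗[k] A →ₗ[k] (A ⊗[k] A) ⊗[k] A :=
  (TensorProduct.comm k A A).toLinearMap.rTensor A

/-- `id ⊗ f` followed by reassociation. -/
def lTensorAssoc (f : A →ₗ[k] A ⊗[k] A) : A ⊗[k] A →ₗ[k] (A ⊗[k] A) ⊗[k] A :=
  (TensorProduct.assoc k A A A).symm.toLinearMap ∘ₗ f.lTensor A

/-- The map `f` followed by the flip. -/
def opp (f : A →ₗ[k] A ⊗[k] A) : A →ₗ[k] A ⊗[k] A :=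
  (TensorProduct.comm k A A).toLinearMap ∘ₗ f

variable (f : A →ₗ[k] A ⊗[k] A) (w : A ⊗[k] A)

theorem rTensor_opp : (opp f).rTensor A w = swapLeft k A (f.rTensor A w) := by
  rw [opp, LinearMap.rTensor_comp]
  rfl

theorem lTensorAssoc_comm :
    lTensorAssoc f (TensorProduct.comm k A A w) = cyclicShift k A (f.rTensor A w) := by
  induction w using TensorProduct.induction_on with
  | zero => simp
  | add x y hx hy => simp only [map_add, hx, hy]
  | tmul a b => rfl

theorem swapLeft_cyclicShift (z : (A ⊗[k] A) ⊗[k] A) :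
    swapLeft k A (cyclicShift k A z) = swapRight k A z :=
  LinearMap.congr_fun (TensorProduct.ext_threefold (g := swapLeft k A ∘ₗ cyclicShift k A)
    (h := swapRight k A) fun _ _ _ => rfl) z

theorem swapLeft_swapRight (z : (A ⊗[k] A) ⊗[k] A) :
    swapLeft k A (swapRight k A z) = cyclicShift k A z :=
  LinearMap.congr_fun (TensorProduct.ext_threefold (g := swapLeft k A ∘ₗ swapRight k A)
    (h := cyclicShift k A) fun _ _ _ => rfl) z

theorem swapRight_cyclicShift (z : (A ⊗[k] A) ⊗[k] A) :
    swapRight k A (cyclicShift k A z) = cyclicShift k A (swapLeft k A z) :=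
  LinearMap.congr_fun (TensorProduct.ext_threefold (g := swapRight k A ∘ₗ cyclicShift k A)
    (h := cyclicShift k A ∘ₗ swapLeft k A) fun _ _ _ => rfl) z

theorem lTensorAssoc_opp : lTensorAssoc (opp f) w = swapRight k A (lTensorAssoc f w) := by
  induction w using TensorProduct.induction_on with
  | zero => simp
  | add x y hx hy => simp only [map_add, hx, hy]
  | tmul a b =>
    change (TensorProduct.assoc k A A A).symm (a ⊗ₜ TensorProduct.comm k A A (f b))
      = swapRight k A ((TensorProduct.assoc k A A A).symm (a ⊗ₜ f b))
    generalize f b = z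
    induction z using TensorProduct.induction_on with
    | zero => simp
    | add x y hx hy => simp only [map_add, TensorProduct.tmul_add, hx, hy]
    | tmul c d => rfl

theorem rTensor_comm : f.rTensor A (TensorProduct.comm k A A w)
    = swapRight k A (swapLeft k A (lTensorAssoc f w)) := by
  induction w using TensorProduct.induction_on with
  | zero => simp
  | add x y hx hy => simp only [map_add, hx, hy]
  | tmul a b =>
    change f b ⊗ₜ a
      = swapRight k A (swapLeft k A ((TensorProduct.assoc k A A A).symm (a ⊗ₜ f b)))
    generalize f b = z
    induction z using TensorProduct.induction_on with
    | zero => simp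
    | add x y hx hy => simp only [map_add, TensorProduct.tmul_add, TensorProduct.add_tmul, hx, hy]
    | tmul c d => rfl

/-- The difference of the two sides of the pre-Lie coalgebra identity. -/
def coPreLieDefect (Δ : A →ₗ[k] A ⊗[k] A) (a : A) : (A ⊗[k] A) ⊗[k] A :=
  (Δ.rTensor A (Δ a) - swapLeft k A (Δ.rTensor A (Δ a)))
    - (lTensorAssoc Δ (Δ a) - swapLeft k A (lTensorAssoc Δ (Δ a)))

theorem isPreLieCoalgebra_iff {Δ : A →ₗ[k] A ⊗[k] A} :
    IsPreLieCoalgebra Δ ↔ ∀ a, coPreLieDefect Δ a = 0 :=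
  forall_congr' fun _ => sub_eq_zero.symm

/-- The formal core of co-Jacobi. In the application `a`, `b`, `c` are the contractions of one
element with triple products whose last factors are `q`, `r`, `s`; the swapped term exchanges `q`
and `r`, hence `a` and `b`. -/
theorem coJacobi_sum (Δ : A →ₗ[k] A ⊗[k] A) (a b c : A) :
    (lTensorAssoc (opp Δ) (opp Δ a - Δ b) - lTensorAssoc Δ (opp Δ a - Δ c))
      - swapLeft k A (lTensorAssoc (opp Δ) (opp Δ b - Δ a) - lTensorAssoc Δ (opp Δ b - Δ c))
      - ((opp Δ).rTensor A (opp Δ a - Δ c) - Δ.rTensor A (opp Δ b - Δ c))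
    = swapRight k A (coPreLieDefect Δ b) - cyclicShift k A (coPreLieDefect Δ a)
      - coPreLieDefect Δ c := by
  have hopp : ∀ a, opp Δ a = TensorProduct.comm k A A (Δ a) := fun _ => rfl
  simp only [coPreLieDefect, map_sub, rTensor_opp, lTensorAssoc_opp, hopp, lTensorAssoc_comm,
    rTensor_comm, swapLeft_cyclicShift, swapLeft_swapRight, swapRight_cyclicShift]
  abel

end Permutation


/-! ### Consequences of the perm identity and of invariance -/

section Quadratic

variable {k A P G : Type*} [Field k] [AddCommGroup A] [Module k A] [AddCommGroup P] [Module k P]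
  [AddCommGroup G] [DecidableEq G] {𝒬 : G → Submodule k P} [DirectSum.Decomposition 𝒬]
  {m : P →ₗ[k] P →ₗ[k] P} {κ : P →ₗ[k] P →ₗ[k] k}

theorem add_sub_add_eq_of_add_eq {g h i j d : G} (hg : g + i = d) (hh : h + j = d) :
    g + h - d + (i + j) = d := by
  have e : g + h - d + (i + j) = g + i + (h + j) - d := by abel
  rw [e, hg, hh, add_sub_cancel_right]

theorem IsPerm.left_comm (h : IsPerm m) (p q r : P) : m p (m q r) = m q (m p r) := by
  rw [(h p q r).1, (h p q r).2, ← (h q p r).1]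

theorem IsPerm.assoc (h : IsPerm m) (p q r : P) : m (m p q) r = m p (m q r) :=
  (h p q r).1.symm

/-- Invariance for `(p, q, r)` and for `(r, q, p)`, combined using skew-symmetry, makes the terms
with `p·r`-type ordering defects cancel. -/
theorem IsQuadraticGradedPerm.form_mul_right (h : IsQuadraticGradedPerm 𝒬 m κ) (p q r : P) :
    κ p (m q r) = -κ r (m q p) := by
  have h1 := h.invariant p q r
  have h2 := h.invariant r q p
  have h3 := h.skew (m p q) r
  have h4 := h.skew (m r q) p
  rw [map_sub] at h1 h2
  linear_combination h3 - h1 + h4 - h2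

/-- Self-adjointness of left multiplication, which moves `u` from the contracted element to the test
element. -/
theorem IsQuadraticGradedPerm.form_mul_left (h : IsQuadraticGradedPerm 𝒬 m κ) (u w q : P) :
    κ (m u w) q = κ w (m u q) := by
  rw [h.skew, h.form_mul_right, neg_neg]

/-! ### Local finiteness -/

/-- The component `(g, h)` is tested by products of degree `2d - g - h`, which pair nontrivially
only with degree `g + h - d`. So only that one degree contributes. -/
theorem locallyFinite_inducedCobracket (hQ : IsQuadraticGradedPerm 𝒬 m κ) {d : G}
    (hd : IsGradedForm 𝒬 κ d) {ΔP : P →ₗ[k] CompletedTensor 𝒬 𝒬}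
    (hΔ : IsInducedCoproduct 𝒬 m κ ΔP) (ΔA : A →ₗ[k] A ⊗[k] A) :
    LocallyFinite (tensorGrading A 𝒬) (inducedCobracket 𝒬 ΔA ΔP) := by
  rintro ⟨g, h⟩
  refine (Set.finite_singleton (g + h - d)).subset ?_
  rintro i ⟨v, hv, hne⟩
  by_contra hi
  have hdeg : i + (d - g + (d - h)) ≠ d := fun e => hi (by
    rw [Set.mem_singleton_iff, ← sub_eq_zero, ← sub_eq_zero.2 e]; abel)
  refine hne (eq_of_contr₂_eq hQ.finiteDimensional hQ.nondegenerate hd fun q hq r hr => ?_)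
  rw [contr₂_inducedCobracket hd hΔ ΔA hq hr (add_sub_cancel _ _) (add_sub_cancel _ _),
    contr_eq_zero hd hdeg (hQ.mul_mem _ _ q hq r hr) hv,
    contr_eq_zero hd hdeg (add_comm (d - g) (d - h) ▸ hQ.mul_mem _ _ r hr q hq) hv]
  simp

theorem inducedBracket_tmul (mA : A →ₗ[k] A →ₗ[k] A) (a b : A) (p q : P) :
    inducedBracket mA m (a ⊗ₜ p) (b ⊗ₜ q) = mA a b ⊗ₜ m p q - mA b a ⊗ₜ m q p := rfl

theorem inducedBracket_mem (hQ : IsQuadraticGradedPerm 𝒬 m κ) (mA : A →ₗ[k] A →ₗ[k] A) {i j : G}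
    (a : A) {u : P} (hu : u ∈ 𝒬 i) {y : A ⊗[k] P} (hy : y ∈ tensorGrading A 𝒬 j) :
    inducedBracket mA m (a ⊗ₜ u) y ∈ tensorGrading A 𝒬 (i + j) := by
  refine tensorGrading_induction
    (motive := fun y => inducedBracket mA m (a ⊗ₜ u) y ∈ tensorGrading A 𝒬 (i + j))
    (fun b p hp => ?_) (fun x y hx hy => ?_) hy
  · rw [inducedBracket_tmul]
    exact sub_mem (tmul_mem_tensorGrading _ (hQ.mul_mem _ _ u hu p hp))
      (tmul_mem_tensorGrading _ (add_comm i j ▸ hQ.mul_mem _ _ p hp u hu))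
  · rw [map_add]
    exact add_mem hx hy

theorem toPi_apply (𝒬 : G → Submodule k P) [DirectSum.Decomposition 𝒬] (p : P) (g : G) :
    toPi 𝒬 p g = DirectSum.decompose 𝒬 p g := rfl

theorem locallyFinite_ad (hQ : IsQuadraticGradedPerm 𝒬 m κ) (mA : A →ₗ[k] A →ₗ[k] A)
    (x : A ⊗[k] P) :
    LocallyFinite (tensorGrading A 𝒬) (toPi (tensorGrading A 𝒬) ∘ₗ inducedBracket mA m x) := by
  induction x using tensor_homogeneous_induction 𝒬 with
  | add x y hx hy =>
    rw [map_add, LinearMap.comp_add]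
    exact hx.add hy
  | tmul a i u hu =>
    refine fun g => (Set.finite_singleton (g - i)).subset ?_
    rintro j ⟨v, hv, hne⟩
    by_contra hj
    refine hne (Subtype.ext ?_)
    rw [LinearMap.comp_apply, toPi_apply,
      DirectSum.decompose_of_mem_ne _ (inducedBracket_mem hQ mA a hu hv)]
    · rfl
    · rintro rfl
      exact hj (by simp)

/-! ### The co-Jacobi identity -/

theorem contr₃_assocHat (q r s : P) (g h l : G)
    (x : ∀ t : G × (G × G), tensorGrading A 𝒬 t.1 ⊗[k]
      (tensorGrading A 𝒬 t.2.1 ⊗[k] tensorGrading A 𝒬 t.2.2)) :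
    contr₃ A κ q r s g h l (assocHat (tensorGrading A 𝒬) x ((g, h), l))
      = (TensorProduct.assoc k A A A).symm
        (TensorProduct.map (contrOn A κ q g) (contr₂ A κ r s h l) (x (g, (h, l)))) := by
  change contr₃ A κ q r s g h l ((TensorProduct.assoc k _ _ _).symm (x (g, (h, l)))) = _
  exact (LinearMap.congr_fun (TensorProduct.map_map_comp_assoc_symm_eq _ _ _) _)

theorem contr₃_flipLeftHat (q r s : P) (g h l : G) (x : CompletedTensor₃ (tensorGrading A 𝒬)) :
    contr₃ A κ q r s g h l (flipLeftHat (tensorGrading A 𝒬) x ((g, h), l))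
      = swapLeft k A (contr₃ A κ r q s h g l (x ((h, g), l))) := by
  change contr₃ A κ q r s g h l ((TensorProduct.comm k _ _).toLinearMap.rTensor _
    (x ((h, g), l))) = _
  generalize x ((h, g), l) = z
  induction z using TensorProduct.induction_on with
  | zero => simp
  | add x y hx hy => simp only [map_add, hx, hy]
  | tmul a b =>
    exact congrArg (· ⊗ₜ[k] contrOn A κ s l b) (TensorProduct.map_comm _ _ _)

section

variable (hQ : IsQuadraticGradedPerm 𝒬 m κ) {d : G} (hd : IsGradedForm 𝒬 κ d)
  {ΔP : P →ₗ[k] CompletedTensor 𝒬 𝒬} (hΔ : IsInducedCoproduct 𝒬 m κ ΔP)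
  (ΔA : A →ₗ[k] A ⊗[k] A) {i j l : G} {q r s : P} (hq : q ∈ 𝒬 i) (hr : r ∈ 𝒬 j) (hs : s ∈ 𝒬 l)
  {g h e : G} (hg : g + i = d) (hh : h + j = d) (he : e + l = d) (x : A ⊗[k] P)

include hQ hd hΔ hq hr hs hg hh he

/-- Contracting the inner cobracket with `r ⊗ s` turns it into maps on contractions with `s·r` and
`r·s`; the outer cobracket is then contracted with `q` and one of these products. -/
theorem contr₃_mapRightHat_inducedCobracket :
    contr₃ A κ q r s g h e (assocHat (tensorGrading A 𝒬)
        (mapRightHat (tensorGrading A 𝒬) (tensorGrading A 𝒬) (inducedCobracket 𝒬 ΔA ΔP)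
          (inducedCobracket 𝒬 ΔA ΔP x)) ((g, h), e))
      = lTensorAssoc (opp ΔA)
          (opp ΔA (contr A κ (m r (m s q)) x) - ΔA (contr A κ (m q (m s r)) x))
        - lTensorAssoc ΔA
          (opp ΔA (contr A κ (m r (m s q)) x) - ΔA (contr A κ (m q (m r s)) x)) := by
  have hrs := hQ.mul_mem _ _ r hr s hs
  have hsr : m s r ∈ 𝒬 (j + l) := add_comm j l ▸ hQ.mul_mem _ _ s hs r hr
  have hdeg : h + e - d + (j + l) = d := add_sub_add_eq_of_add_eq hh he
  rw [contr₃_assocHat, map_mapRightHat (locallyFinite_inducedCobracket hQ hd hΔ ΔA) (g, (h, e)) _ _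
    (opp ΔA ∘ₗ contr A κ (m s r) - ΔA ∘ₗ contr A κ (m r s))
    (fun v => contr₂_inducedCobracket hd hΔ ΔA hr hs hh he v) (h + e - d)]
  · have hcomp : TensorProduct.map (contrOn A κ q g)
        ((opp ΔA ∘ₗ contr A κ (m s r) - ΔA ∘ₗ contr A κ (m r s)) ∘ₗ
          (tensorGrading A 𝒬 (h + e - d)).subtype)
        = (opp ΔA).lTensor A ∘ₗ contr₂ A κ q (m s r) g (h + e - d)
          - ΔA.lTensor A ∘ₗ contr₂ A κ q (m r s) g (h + e - d) := by
      ext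
      simp [contr₂, contrOn, TensorProduct.tmul_sub]
    rw [hcomp, LinearMap.sub_apply, LinearMap.comp_apply, LinearMap.comp_apply,
      contr₂_inducedCobracket hd hΔ ΔA hq hsr hg hdeg,
      contr₂_inducedCobracket hd hΔ ΔA hq hrs hg hdeg, map_sub]
    -- Products with the same last factor are brought to a common form, leaving three distinct
    -- contractions.
    rw [hQ.perm.assoc, hQ.perm.assoc, hQ.perm.left_comm s r q]
    rfl
  · intro g' hg' v hv
    have hne : g' + (j + l) ≠ d := fun e' => hg' (add_right_cancel (e'.trans hdeg.symm))
    simp [contr_eq_zero hd hne hsr hv, contr_eq_zero hd hne hrs hv]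

theorem contr₃_mapLeftHat_inducedCobracket :
    contr₃ A κ q r s g h e
        (mapLeftHat (tensorGrading A 𝒬) (tensorGrading A 𝒬) (inducedCobracket 𝒬 ΔA ΔP)
          (inducedCobracket 𝒬 ΔA ΔP x) ((g, h), e))
      = (opp ΔA).rTensor A
          (opp ΔA (contr A κ (m r (m s q)) x) - ΔA (contr A κ (m q (m r s)) x))
        - ΔA.rTensor A
          (opp ΔA (contr A κ (m q (m s r)) x) - ΔA (contr A κ (m q (m r s)) x)) := by
  have hqr := hQ.mul_mem _ _ q hq r hr
  have hrq : m r q ∈ 𝒬 (i + j) := add_comm i j ▸ hQ.mul_mem _ _ r hr q hq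
  have hdeg : g + h - d + (i + j) = d := add_sub_add_eq_of_add_eq hg hh
  rw [contr₃, map_mapLeftHat (locallyFinite_inducedCobracket hQ hd hΔ ΔA) ((g, h), e) _ _
    (opp ΔA ∘ₗ contr A κ (m r q) - ΔA ∘ₗ contr A κ (m q r))
    (fun v => contr₂_inducedCobracket hd hΔ ΔA hq hr hg hh v) (g + h - d)]
  · have hcomp : TensorProduct.map
        ((opp ΔA ∘ₗ contr A κ (m r q) - ΔA ∘ₗ contr A κ (m q r)) ∘ₗ
          (tensorGrading A 𝒬 (g + h - d)).subtype) (contrOn A κ s e)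
        = (opp ΔA).rTensor A ∘ₗ contr₂ A κ (m r q) s (g + h - d) e
          - ΔA.rTensor A ∘ₗ contr₂ A κ (m q r) s (g + h - d) e := by
      ext
      simp [contr₂, contrOn, TensorProduct.sub_tmul]
    rw [hcomp, LinearMap.sub_apply, LinearMap.comp_apply, LinearMap.comp_apply,
      contr₂_inducedCobracket hd hΔ ΔA hrq hs hdeg he,
      contr₂_inducedCobracket hd hΔ ΔA hqr hs hdeg he]
    rw [hQ.perm.assoc, hQ.perm.assoc, hQ.perm.left_comm s r q, hQ.perm.left_comm s q r,
      hQ.perm.left_comm r q s]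
    rfl
  · intro g' hg' v hv
    have hne : g' + (i + j) ≠ d := fun e' => hg' (add_right_cancel (e'.trans hdeg.symm))
    simp [contr_eq_zero hd hne hrq hv, contr_eq_zero hd hne hqr hv]

theorem contr₃_coJacobi :
    contr₃ A κ q r s g h e
      ((assocHat (tensorGrading A 𝒬)
          (mapRightHat (tensorGrading A 𝒬) (tensorGrading A 𝒬) (inducedCobracket 𝒬 ΔA ΔP)
            (inducedCobracket 𝒬 ΔA ΔP x))
        - flipLeftHat (tensorGrading A 𝒬) (assocHat (tensorGrading A 𝒬)
          (mapRightHat (tensorGrading A 𝒬) (tensorGrading A 𝒬) (inducedCobracket 𝒬 ΔA ΔP)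
            (inducedCobracket 𝒬 ΔA ΔP x)))
        - mapLeftHat (tensorGrading A 𝒬) (tensorGrading A 𝒬) (inducedCobracket 𝒬 ΔA ΔP)
          (inducedCobracket 𝒬 ΔA ΔP x)) ((g, h), e))
      = swapRight k A (coPreLieDefect ΔA (contr A κ (m q (m s r)) x))
        - cyclicShift k A (coPreLieDefect ΔA (contr A κ (m r (m s q)) x))
        - coPreLieDefect ΔA (contr A κ (m q (m r s)) x) := by
  rw [Pi.sub_apply, Pi.sub_apply, map_sub, map_sub, contr₃_flipLeftHat,
    contr₃_mapRightHat_inducedCobracket hQ hd hΔ ΔA hq hr hs hg hh he,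
    contr₃_mapRightHat_inducedCobracket hQ hd hΔ ΔA hr hq hs hh hg he,
    contr₃_mapLeftHat_inducedCobracket hQ hd hΔ ΔA hq hr hs hg hh he,
    hQ.perm.left_comm r q s, coJacobi_sum]

end

end Quadratic

section Bialgebra

variable {k A P G : Type*} [Field k] [AddCommGroup A] [Module k A] [AddCommGroup P] [Module k P]
  [AddCommGroup G] [DecidableEq G] {𝒬 : G → Submodule k P} [DirectSum.Decomposition 𝒬]
  {m : P →ₗ[k] P →ₗ[k] P} {κ : P →ₗ[k] P →ₗ[k] k}

/-! ### The Jacobi identity -/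

/-- The difference of the two sides of the pre-Lie identity. -/
def preLieDefect (mA : A →ₗ[k] A →ₗ[k] A) (a b c : A) : A :=
  mA (mA a b) c - mA a (mA b c) - (mA (mA b a) c - mA b (mA a c))

/-- The twelve terms of the Jacobi sum are grouped by the last factor of the `P`-product, four for
each of `r`, `p`, `q`. -/
theorem jacobi_tmul (hm : IsPerm m) (mA : A →ₗ[k] A →ₗ[k] A) (a b c : A) (p q r : P) :
    inducedBracket mA m (inducedBracket mA m (a ⊗ₜ p) (b ⊗ₜ q)) (c ⊗ₜ r)
      + inducedBracket mA m (inducedBracket mA m (b ⊗ₜ q) (c ⊗ₜ r)) (a ⊗ₜ p)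
      + inducedBracket mA m (inducedBracket mA m (c ⊗ₜ r) (a ⊗ₜ p)) (b ⊗ₜ q)
    = preLieDefect mA a b c ⊗ₜ m p (m q r) + preLieDefect mA b c a ⊗ₜ m q (m r p)
      + preLieDefect mA c a b ⊗ₜ m p (m r q) := by
  simp only [inducedBracket_tmul, map_sub, LinearMap.sub_apply, preLieDefect,
    TensorProduct.sub_tmul, hm.assoc]
  rw [hm.left_comm r p q, hm.left_comm r q p, hm.left_comm q p r]
  abel

theorem isLieBracket_inducedBracket (hm : IsPerm m) {mA : A →ₗ[k] A →ₗ[k] A} (hA : IsPreLie mA) :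
    IsLieBracket (inducedBracket mA m) where
  alternating x := sub_self _
  jacobi x y z := by
    have h0 : ∀ a b c, preLieDefect mA a b c = 0 := fun a b c => sub_eq_zero.2 (hA a b c)
    induction x using TensorProduct.induction_on with
    | zero => simp
    | add x x' hx hx' =>
      -- Writing the right-hand side as `0 + 0` lets each zero be replaced by an induction
      -- hypothesis; additivity finishes.
      rw [← add_zero (0 : A ⊗[k] P)]
      nth_rw 1 [← hx]
      rw [← hx']
      simp only [map_add, LinearMap.add_apply]
      abel
    | tmul a p =>
      induction y using TensorProduct.induction_on with
      | zero => simp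
      | add x x' hx hx' =>
        rw [← add_zero (0 : A ⊗[k] P)]
        nth_rw 1 [← hx]
        rw [← hx']
        simp only [map_add, LinearMap.add_apply]
        abel
      | tmul b q =>
        induction z using TensorProduct.induction_on with
        | zero => simp
        | add x x' hx hx' =>
          rw [← add_zero (0 : A ⊗[k] P)]
          nth_rw 1 [← hx]
          rw [← hx']
          simp only [map_add, LinearMap.add_apply]
          abel
        | tmul c r => simp [jacobi_tmul hm, h0]

/-! ### The cocycle condition -/

theorem actHat_add {f : A ⊗[k] P →ₗ[k] A ⊗[k] P}
    (hf : LocallyFinite (tensorGrading A 𝒬) (toPi (tensorGrading A 𝒬) ∘ₗ f))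
    (x y : CompletedTensor (tensorGrading A 𝒬) (tensorGrading A 𝒬)) :
    actHat (tensorGrading A 𝒬) f (x + y)
      = actHat (tensorGrading A 𝒬) f x + actHat (tensorGrading A 𝒬) f y := by
  rw [actHat, mapLeftHat_add hf, mapRightHat_add hf, actHat, actHat]
  abel

theorem add_actHat {f f' : A ⊗[k] P →ₗ[k] A ⊗[k] P}
    (hf : LocallyFinite (tensorGrading A 𝒬) (toPi (tensorGrading A 𝒬) ∘ₗ f))
    (hf' : LocallyFinite (tensorGrading A 𝒬) (toPi (tensorGrading A 𝒬) ∘ₗ f'))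
    (x : CompletedTensor (tensorGrading A 𝒬) (tensorGrading A 𝒬)) :
    actHat (tensorGrading A 𝒬) (f + f') x
      = actHat (tensorGrading A 𝒬) f x + actHat (tensorGrading A 𝒬) f' x := by
  rw [actHat, LinearMap.comp_add, add_mapLeftHat hf hf', add_mapRightHat hf hf', actHat, actHat]
  abel

/-- Self-adjointness of left multiplication handles `u·w`, and invariance handles `w·u`; this is the
source of the commutator `u·q - q·u`. -/
theorem contr_inducedBracket (hQ : IsQuadraticGradedPerm 𝒬 m κ) (mA : A →ₗ[k] A →ₗ[k] A) (a : A)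
    (u q : P) (x : A ⊗[k] P) :
    contr A κ q (inducedBracket mA m (a ⊗ₜ u) x)
      = mA a (contr A κ (m u q) x) - mA.flip a (contr A κ (m u q - m q u) x) := by
  induction x using TensorProduct.induction_on with
  | zero => simp
  | add x y hx hy =>
    simp only [map_add, hx, hy]
    abel
  | tmul b w =>
    rw [inducedBracket_tmul, map_sub, contr_tmul, contr_tmul, contr_tmul, contr_tmul,
      hQ.form_mul_left, hQ.invariant, map_smul, map_smul, LinearMap.flip_apply]

section

variable (hQ : IsQuadraticGradedPerm 𝒬 m κ) {d : G} (hd : IsGradedForm 𝒬 κ d)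
  (mA : A →ₗ[k] A →ₗ[k] A) {i₀ i j : G} {u q r : P} (hu : u ∈ 𝒬 i₀) (hq : q ∈ 𝒬 i) (hr : r ∈ 𝒬 j)
  {g h g' h' : G} (hg : g + i = d) (hh : h + j = d)

include hQ hd hu hq hg in
theorem contr₂_mapLeftHat_ad (a : A) (hg' : g' + (i₀ + i) = d)
    (y : CompletedTensor (tensorGrading A 𝒬) (tensorGrading A 𝒬)) :
    contr₂ A κ q r g h (mapLeftHat (tensorGrading A 𝒬) (tensorGrading A 𝒬)
        (toPi (tensorGrading A 𝒬) ∘ₗ inducedBracket mA m (a ⊗ₜ u)) y (g, h))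
      = (mA a).rTensor A (contr₂ A κ (m u q) r g' h (y (g', h)))
        - (mA.flip a).rTensor A (contr₂ A κ (m u q - m q u) r g' h (y (g', h))) := by
  have huq := hQ.mul_mem _ _ u hu q hq
  have hqu : m q u ∈ 𝒬 (i₀ + i) := add_comm i i₀ ▸ hQ.mul_mem _ _ q hq u hu
  rw [contr₂, map_mapLeftHat (locallyFinite_ad hQ mA (a ⊗ₜ u)) (g, h) _ _
    (mA a ∘ₗ contr A κ (m u q) - mA.flip a ∘ₗ contr A κ (m u q - m q u))
    (fun v => (contr_component hd hg hq _).trans (contr_inducedBracket hQ mA a u q v)) g']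
  · rw [← LinearMap.comp_apply, ← LinearMap.comp_apply, ← LinearMap.sub_apply]
    congr 1
    ext
    simp [contr₂, contrOn, TensorProduct.sub_tmul]
  · intro g₁ hg₁ v hv
    have hne : g₁ + (i₀ + i) ≠ d := fun e => hg₁ (add_right_cancel (e.trans hg'.symm))
    rw [LinearMap.sub_apply, LinearMap.comp_apply, LinearMap.comp_apply,
      contr_eq_zero hd hne huq hv, contr_eq_zero hd hne (sub_mem huq hqu) hv, map_zero, map_zero,
      sub_zero]

include hQ hd hu hr hh in
theorem contr₂_mapRightHat_ad (a : A) (hh' : h' + (i₀ + j) = d)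
    (y : CompletedTensor (tensorGrading A 𝒬) (tensorGrading A 𝒬)) :
    contr₂ A κ q r g h (mapRightHat (tensorGrading A 𝒬) (tensorGrading A 𝒬)
        (toPi (tensorGrading A 𝒬) ∘ₗ inducedBracket mA m (a ⊗ₜ u)) y (g, h))
      = (mA a).lTensor A (contr₂ A κ q (m u r) g h' (y (g, h')))
        - (mA.flip a).lTensor A (contr₂ A κ q (m u r - m r u) g h' (y (g, h'))) := by
  have hur := hQ.mul_mem _ _ u hu r hr
  have hru : m r u ∈ 𝒬 (i₀ + j) := add_comm j i₀ ▸ hQ.mul_mem _ _ r hr u hu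
  rw [contr₂, map_mapRightHat (locallyFinite_ad hQ mA (a ⊗ₜ u)) (g, h) _ _
    (mA a ∘ₗ contr A κ (m u r) - mA.flip a ∘ₗ contr A κ (m u r - m r u))
    (fun v => (contr_component hd hh hr _).trans (contr_inducedBracket hQ mA a u r v)) h']
  · rw [← LinearMap.comp_apply, ← LinearMap.comp_apply, ← LinearMap.sub_apply]
    congr 1
    ext
    simp [contr₂, contrOn, TensorProduct.tmul_sub]
  · intro g₁ hg₁ v hv
    have hne : g₁ + (i₀ + j) ≠ d := fun e => hg₁ (add_right_cancel (e.trans hh'.symm))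
    rw [LinearMap.sub_apply, LinearMap.comp_apply, LinearMap.comp_apply,
      contr_eq_zero hd hne hur hv, contr_eq_zero hd hne (sub_mem hur hru) hv, map_zero, map_zero,
      sub_zero]

variable {ΔP : P →ₗ[k] CompletedTensor 𝒬 𝒬} (hΔ : IsInducedCoproduct 𝒬 m κ ΔP)
  (ΔA : A →ₗ[k] A ⊗[k] A)

include hQ hd hu hq hr hg hh hΔ in
theorem contr₂_actHat_ad (a b : A) (v : P) :
    contr₂ A κ q r g h (actHat (tensorGrading A 𝒬) (inducedBracket mA m (a ⊗ₜ u))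
        (inducedCobracket 𝒬 ΔA ΔP (b ⊗ₜ v)) (g, h))
      = κ v (m u (m r q)) • ((mA a).rTensor A (opp ΔA b) + (mA a).lTensor A (opp ΔA b))
        - κ v (m u (m q r)) • ((mA a).rTensor A (ΔA b) + (mA a).lTensor A (ΔA b))
        - (κ v (m u (m r q)) - κ v (m q (m r u))) • (mA.flip a).rTensor A (opp ΔA b)
        + (κ v (m u (m q r)) - κ v (m q (m r u))) • (mA.flip a).lTensor A (ΔA b) := by
  have huq := hQ.mul_mem _ _ u hu q hq
  have hqu : m q u ∈ 𝒬 (i₀ + i) := add_comm i i₀ ▸ hQ.mul_mem _ _ q hq u hu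
  have hur := hQ.mul_mem _ _ u hu r hr
  have hru : m r u ∈ 𝒬 (i₀ + j) := add_comm j i₀ ▸ hQ.mul_mem _ _ r hr u hu
  have hg' : d - (i₀ + i) + (i₀ + i) = d := sub_add_cancel _ _
  have hh' : d - (i₀ + j) + (i₀ + j) = d := sub_add_cancel _ _
  have hm := hQ.perm
  have hopp : ∀ a, TensorProduct.comm k A A (ΔA a) = opp ΔA a := fun _ => rfl
  rw [actHat, Pi.add_apply, map_add, contr₂_mapLeftHat_ad hQ hd mA hu hq hg a hg',
    contr₂_mapRightHat_ad hQ hd mA hu hr hh a hh',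
    contr₂_inducedCobracket hd hΔ ΔA huq hr hg' hh,
    contr₂_inducedCobracket hd hΔ ΔA (sub_mem huq hqu) hr hg' hh,
    contr₂_inducedCobracket hd hΔ ΔA hq hur hg hh',
    contr₂_inducedCobracket hd hΔ ΔA hq (sub_mem hur hru) hg hh']
  simp only [contr_tmul, map_sub, map_smul, LinearMap.sub_apply, hm.assoc, hopp,
    hm.left_comm r u q, hm.left_comm r q u, hm.left_comm q u r]
  module

include hQ hd hu hq hr hg hh hΔ in
-- All coefficients reduce to pairings of `v` with products of `u`, `q`, `r`, of which there are
-- three, with last factor `r`, `q` or `u`. Collecting terms assembles the values of `ζ`.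
theorem contr₂_compatible (a b : A) {j₀ : G} {v : P} (hv : v ∈ 𝒬 j₀) :
    contr₂ A κ q r g h
      ((inducedCobracket 𝒬 ΔA ΔP (inducedBracket mA m (a ⊗ₜ u) (b ⊗ₜ v))
        - (actHat (tensorGrading A 𝒬) (inducedBracket mA m (a ⊗ₜ u))
            (inducedCobracket 𝒬 ΔA ΔP (b ⊗ₜ v))
          - actHat (tensorGrading A 𝒬) (inducedBracket mA m (b ⊗ₜ v))
            (inducedCobracket 𝒬 ΔA ΔP (a ⊗ₜ u)))) (g, h))
      = κ v (m u (m q r)) • (zeta mA ΔA b a - zeta mA ΔA a b)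
        + κ v (m u (m r q)) • TensorProduct.comm k A A (zeta mA ΔA a b - zeta mA ΔA b a)
        + κ v (m q (m r u)) • (TensorProduct.comm k A A (zeta mA ΔA b a) - zeta mA ΔA b a) := by
  have hm := hQ.perm
  have hopp : ∀ a, TensorProduct.comm k A A (ΔA a) = opp ΔA a := fun _ => rfl
  -- The action of `b ⊗ v` produces pairings with `u` in the first slot; these three identities turn
  -- them into pairings with `v`.
  have h1 : κ u (m q (m r v)) = -κ v (m q (m r u)) := by
    rw [← hm.assoc, hQ.form_mul_right, hm.assoc]
  have h2 : κ u (m v (m q r)) = κ v (m u (m q r)) - κ v (m q (m r u)) := by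
    rw [← hQ.form_mul_left, hQ.invariant, map_sub, hm.assoc q r u]
  have h3 : κ u (m v (m r q)) = κ v (m u (m r q)) - κ v (m q (m r u)) := by
    rw [← hQ.form_mul_left, hQ.invariant, map_sub, hm.assoc r q u, hm.left_comm r q u]
  have hr' : ∀ (f : A →ₗ[k] A) (w : A ⊗[k] A), TensorProduct.comm k A A (f.rTensor A w)
      = f.lTensor A (TensorProduct.comm k A A w) := fun f w => (TensorProduct.map_comm _ _ _).symm
  have hl' : ∀ (f : A →ₗ[k] A) (w : A ⊗[k] A), TensorProduct.comm k A A (f.lTensor A w)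
      = f.rTensor A (TensorProduct.comm k A A w) := fun f w => (TensorProduct.map_comm _ _ _).symm
  rw [Pi.sub_apply, Pi.sub_apply, map_sub, map_sub,
    contr₂_actHat_ad hQ hd mA hu hq hr hg hh hΔ ΔA, contr₂_actHat_ad hQ hd mA hv hq hr hg hh hΔ ΔA,
    contr₂_inducedCobracket hd hΔ ΔA hq hr hg hh]
  simp only [inducedBracket_tmul, contr_tmul, map_sub, map_add, map_smul, zeta, hr', hl', hopp,
    hQ.form_mul_left, h1, h2, h3]
  module

end

/-! ### Pre-Lie bialgebras induce completed Lie bialgebras -/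

theorem flipHat_flipHat (x : CompletedTensor 𝒬 𝒬) : flipHat 𝒬 (flipHat 𝒬 x) = x :=
  funext fun t => (TensorProduct.comm k (𝒬 t.1) (𝒬 t.2)).symm_apply_apply _

theorem isCompletedLieBialgebra_of_isPreLieBialgebra (hQ : IsQuadraticGradedPerm 𝒬 m κ)
    {ΔP : P →ₗ[k] CompletedTensor 𝒬 𝒬} (hΔ : IsInducedCoproduct 𝒬 m κ ΔP)
    {mA : A →ₗ[k] A →ₗ[k] A} {ΔA : A →ₗ[k] A ⊗[k] A} (hA : IsPreLieBialgebra mA ΔA) :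
    IsCompletedLieBialgebra (tensorGrading A 𝒬) (inducedBracket mA m)
      (inducedCobracket 𝒬 ΔA ΔP) := by
  obtain ⟨d, hd⟩ := hQ.graded
  replace hd : IsGradedForm 𝒬 κ d := hd
  have had := locallyFinite_ad hQ mA
  refine ⟨isLieBracket_inducedBracket hQ.perm hA.preLie,
    ⟨locallyFinite_inducedCobracket hQ hd hΔ ΔA, fun x => ?_, fun x => ?_⟩, had, fun x y => ?_⟩
  -- The cobracket lies in the image of `id - σ̂` and `σ̂` is an involution.
  · have h : inducedCobracket 𝒬 ΔA ΔP x = bullet A 𝒬 (TensorProduct.map ΔA ΔP x)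
        - flipHat (tensorGrading A 𝒬) (bullet A 𝒬 (TensorProduct.map ΔA ΔP x)) := rfl
    rw [h, map_sub, flipHat_flipHat]
    abel
  · have h0 := isPreLieCoalgebra_iff.1 hA.preLieCoalgebra
    refine funext fun ⟨⟨g, h⟩, e⟩ =>
      eq_of_contr₃_eq hQ.finiteDimensional hQ.nondegenerate hd fun q hq r hr s hs => ?_
    refine (contr₃_coJacobi hQ hd hΔ ΔA hq hr hs (add_sub_cancel _ _) (add_sub_cancel _ _)
      (add_sub_cancel _ _) x).trans ?_
    simp [h0]
  · induction x using tensor_homogeneous_induction 𝒬 with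
    | add x x' hx hx' =>
      rw [map_add, LinearMap.add_apply, map_add, hx, hx', add_actHat (had x) (had x'), map_add,
        actHat_add (had y)]
      abel
    | tmul a i u hu =>
      induction y using tensor_homogeneous_induction 𝒬 with
      | add y y' hy hy' =>
        rw [map_add, map_add, map_add, hy, hy', map_add, add_actHat (had y) (had y'),
          actHat_add (had _)]
        abel
      | tmul b j v hv =>
        refine sub_eq_zero.1 (funext fun ⟨g, h⟩ =>
          eq_of_contr₂_eq hQ.finiteDimensional hQ.nondegenerate hd fun q hq r hr => ?_)
        refine (contr₂_compatible hQ hd mA hu hq hr (add_sub_cancel _ _) (add_sub_cancel _ _) hΔ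
          ΔA a b hv).trans ?_
        rw [hA.zeta_comm, sub_self, hA.zeta_symm, sub_self]
        simp

end Bialgebra

/-! ### The perm algebra of Laurent vector fields -/

section Laurent

variable {k : Type*} [Field k]

theorem laurentMul_single (b c : LaurentIndex) (x y : k) :
    laurentMul k (Finsupp.single b x) (Finsupp.single c y)
      = Finsupp.single (b.1 + c.1 + unitExp b.2, c.2) (x * y) := by
  simp [laurentMul]

/-- The value of the form on two monomial vector fields. -/
def laurentPairing (k : Type*) [Field k] (b c : LaurentIndex) : k :=
  if b.1 + c.1 = 0 then
    (if b.2 = 1 ∧ c.2 = 0 then 1 else if b.2 = 0 ∧ c.2 = 1 then -1 else 0)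
  else 0

theorem laurentForm_single (b c : LaurentIndex) (x y : k) :
    laurentForm k (Finsupp.single b x) (Finsupp.single c y) = x * y * laurentPairing k b c := by
  rw [laurentForm, Finsupp.linearCombination_single, LinearMap.smul_apply,
    Finsupp.linearCombination_single, smul_eq_mul, smul_eq_mul, mul_assoc, laurentPairing]

theorem isPerm_laurentMul : IsPerm (laurentMul k) := by
  intro p q r
  induction p using Finsupp.induction_linear with
  | zero => simp
  | add x y hx hy => simp only [map_add, LinearMap.add_apply, hx.1, hy.1, hx.2, hy.2, and_self]
  | single b x =>
    induction q using Finsupp.induction_linear with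
    | zero => simp
    | add x y hx hy => simp only [map_add, LinearMap.add_apply, hx.1, hy.1, hx.2, hy.2, and_self]
    | single c y =>
      induction r using Finsupp.induction_linear with
      | zero => simp
      | add x y hx hy => simp only [map_add, hx.1, hy.1, hx.2, hy.2, and_self]
      | single e z =>
        simp only [laurentMul_single]
        constructor <;> congr 1
        · congr 1
          abel
        · ring
        · congr 1
          abel
        · ring

theorem laurentForm_skew (p q : LaurentField k) : laurentForm k p q = -laurentForm k q p := by
  induction p using Finsupp.induction_linear with
  | zero => simp
  | add x y hx hy => simp only [map_add, LinearMap.add_apply, hx, hy, neg_add]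
  | single b x =>
    induction q using Finsupp.induction_linear with
    | zero => simp
    | add x y hx hy => simp only [map_add, LinearMap.add_apply, hx, hy, neg_add]
    | single c y =>
      obtain ⟨b, s⟩ := b
      obtain ⟨c, t⟩ := c
      rw [laurentForm_single, laurentForm_single, laurentPairing, laurentPairing, add_comm c b]
      split_ifs <;> simp_all [mul_comm]

/-- With `ε` the sign of the form and `N = b + c + e`, this reads `ε_{tw} δ(N+e_s) = ε_{sw} δ(N+e_t)
- ε_{st} δ(N+e_w)`. The difference of the sides is alternating in three indices taking two values,
hence zero. -/
theorem laurentPairing_mul (b c e : ℤ × ℤ) (s t w : Fin 2) :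
    laurentPairing k (b + c + unitExp s, t) (e, w)
      = laurentPairing k (b, s) (c + e + unitExp t, w)
        - laurentPairing k (b, s) (e + c + unitExp w, t) := by
  have h1 : b + c + unitExp s + e = b + c + e + unitExp s := by abel
  have h2 : b + (c + e + unitExp t) = b + c + e + unitExp t := by abel
  have h3 : b + (e + c + unitExp w) = b + c + e + unitExp w := by abel
  simp only [laurentPairing, h1, h2, h3]
  fin_cases s <;> fin_cases t <;> fin_cases w <;> simp <;> split_ifs <;> simp

theorem laurentForm_invariant (p q r : LaurentField k) :
    laurentForm k (laurentMul k p q) r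
      = laurentForm k p (laurentMul k q r - laurentMul k r q) := by
  induction p using Finsupp.induction_linear with
  | zero => simp
  | add x y hx hy => simp only [map_add, LinearMap.add_apply, hx, hy]
  | single b x =>
    induction q using Finsupp.induction_linear with
    | zero => simp
    | add x y hx hy =>
      simp only [map_add, LinearMap.add_apply, hx, hy, map_sub]
      ring
    | single c y =>
      induction r using Finsupp.induction_linear with
      | zero => simp
      | add x y hx hy =>
        simp only [map_add, LinearMap.add_apply, hx, hy, map_sub]
        ring
      | single e z =>
        rw [map_sub]
        simp only [laurentMul_single, laurentForm_single]
        rw [laurentPairing_mul b.1 c.1 e.1 b.2 c.2 e.2]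
        ring

theorem laurentForm_apply_single_zero (p : LaurentField k) (i : ℤ × ℤ) :
    laurentForm k p (Finsupp.single (i, 0) 1) = p (-i, 1) := by
  induction p using Finsupp.induction_linear with
  | zero => simp
  | add x y hx hy => simp only [map_add, LinearMap.add_apply, hx, hy, Finsupp.add_apply]
  | single b x =>
    obtain ⟨b, s⟩ := b
    rw [laurentForm_single, laurentPairing, Finsupp.single_apply]
    fin_cases s <;> simp [add_eq_zero_iff_eq_neg]

theorem laurentForm_apply_single_one (p : LaurentField k) (i : ℤ × ℤ) :
    laurentForm k p (Finsupp.single (i, 1) 1) = -p (-i, 0) := by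
  induction p using Finsupp.induction_linear with
  | zero => simp
  | add x y hx hy => simp only [map_add, LinearMap.add_apply, hx, hy, Finsupp.add_apply, neg_add]
  | single b x =>
    obtain ⟨b, s⟩ := b
    rw [laurentForm_single, laurentPairing, Finsupp.single_apply]
    fin_cases s <;> simp [add_eq_zero_iff_eq_neg] <;> split_ifs <;> simp

theorem laurentForm_nondegenerate : (laurentForm k).Nondegenerate := by
  have hleft : (laurentForm k).SeparatingLeft := by
    refine fun p hp => Finsupp.ext fun ⟨i, s⟩ => ?_
    have h0 := laurentForm_apply_single_zero p (-i)
    have h1 := laurentForm_apply_single_one p (-i)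
    rw [hp, neg_neg] at h0 h1
    fin_cases s
    · simpa using h1
    · exact h0.symm
  refine ⟨hleft, fun q hq => hleft q fun p => ?_⟩
  rw [laurentForm_skew, hq, neg_zero]

/-! ### The bidegree and the quadratic graded structure -/

theorem laurentGrading_induction {g : ℤ × ℤ} {motive : LaurentField k → Prop}
    (single : ∀ b, laurentDeg b = g → ∀ x, motive (Finsupp.single b x)) (zero : motive 0)
    (add : ∀ x y, motive x → motive y → motive (x + y)) {p : LaurentField k}
    (hp : p ∈ laurentGrading k g) : motive p := by
  rw [← Finsupp.sum_single p]
  exact Finset.sum_induction _ motive add zero fun b hb => single b (hp hb) _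

theorem single_mem_laurentGrading (b : LaurentIndex) (x : k) :
    Finsupp.single b x ∈ laurentGrading k (laurentDeg b) :=
  Finsupp.single_mem_supported k x rfl

theorem finiteDimensional_laurentGrading (g : ℤ × ℤ) :
    FiniteDimensional k (laurentGrading k g) := by
  have hfin : Finite {b : LaurentIndex | laurentDeg b = g} := by
    refine Set.Finite.subset (Set.finite_range fun s : Fin 2 => ((g - unitExp s, s) : LaurentIndex))
      fun b hb => ⟨b.2, Prod.ext ?_ rfl⟩
    rw [← (hb : laurentDeg b = g)]
    exact add_sub_cancel_right _ _
  exact Module.Finite.equiv (Finsupp.supportedEquivFinsupp _).symm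

theorem laurentMul_mem (i j : ℤ × ℤ) (p : LaurentField k) (hp : p ∈ laurentGrading k i)
    (q : LaurentField k) (hq : q ∈ laurentGrading k j) :
    laurentMul k p q ∈ laurentGrading k (i + j) := by
  refine laurentGrading_induction (motive := fun p => laurentMul k p q ∈ laurentGrading k (i + j))
    (fun b hb x => ?_) (by simp) (fun x y hx hy => ?_) hp
  · refine laurentGrading_induction
      (motive := fun q => laurentMul k (Finsupp.single b x) q ∈ laurentGrading k (i + j))
      (fun c hc y => ?_) (by simp) (fun x y hx hy => ?_) hq
    · have h : laurentDeg (b.1 + c.1 + unitExp b.2, c.2) = i + j := by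
        rw [← hb, ← hc]
        simp only [laurentDeg]
        abel
      rw [laurentMul_single, ← h]
      exact single_mem_laurentGrading _ _
    · rw [map_add]
      exact add_mem hx hy
  · rw [map_add]
    exact add_mem hx hy

/-- Monomials pair nontrivially only when their exponents cancel and their derivations differ, so
their bidegrees add up to `e₁ + e₂ = (1, 1)`. -/
theorem isGradedForm_laurentForm : IsGradedForm (laurentGrading k) (laurentForm k) (1, 1) := by
  intro i j hij p hp q hq
  refine laurentGrading_induction (motive := fun p => laurentForm k p q = 0)
    (fun b hb x => ?_) (by simp) (fun x y hx hy => ?_) hp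
  · refine laurentGrading_induction
      (motive := fun q => laurentForm k (Finsupp.single b x) q = 0)
      (fun c hc y => ?_) (by simp) (fun x y hx hy => ?_) hq
    · obtain ⟨b, s⟩ := b
      obtain ⟨c, t⟩ := c
      have hbc : laurentDeg (b, s) + laurentDeg (c, t) = b + c + (unitExp s + unitExp t) := by
        rw [laurentDeg, laurentDeg]
        abel
      rw [← hb, ← hc, hbc] at hij
      rw [laurentForm_single, laurentPairing]
      by_cases h : b + c = 0
      · rw [h] at hij
        fin_cases s <;> fin_cases t <;> simp_all [unitExp]
      · simp [h]
    · rw [map_add, hx, hy, add_zero]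
  · rw [map_add, LinearMap.add_apply, hx, hy, add_zero]

theorem isQuadraticGradedPerm_laurent :
    IsQuadraticGradedPerm (laurentGrading k) (laurentMul k) (laurentForm k) where
  perm := isPerm_laurentMul
  finiteDimensional := finiteDimensional_laurentGrading
  mul_mem := laurentMul_mem
  skew := laurentForm_skew
  nondegenerate := laurentForm_nondegenerate
  invariant := laurentForm_invariant
  graded := ⟨(1, 1), isGradedForm_laurentForm⟩

/-- The vector field `∂_{s+1}`. -/
def laurentPartial (k : Type*) [Field k] (s : Fin 2) : LaurentField k := Finsupp.single (0, s) 1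

/-- The vector field `x₂^n ∂_{s+1}`. -/
def laurentPow (k : Type*) [Field k] (n : ℤ) (s : Fin 2) : LaurentField k :=
  Finsupp.single ((0, n), s) 1

/-- The product is `x_s x_t ∂_w`; pairing with `x₂⁻²∂₂` requires `x_s x_t = x₂²` and `∂_w = ∂₁`.
This single functional distinguishes the last factor of a triple product. -/
theorem laurentForm_mul_mul (s t w : Fin 2) :
    laurentForm k (laurentPow k (-2) 1)
        (laurentMul k (laurentPartial k s) (laurentMul k (laurentPartial k t) (laurentPartial k w)))
      = if s = 1 ∧ t = 1 ∧ w = 0 then 1 else 0 := by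
  simp only [laurentPow, laurentPartial, laurentMul_single, laurentForm_single, laurentPairing,
    unitExp]
  fin_cases s <;> fin_cases t <;> fin_cases w <;> simp

/-! ### Recovering the pre-Lie bialgebra from Laurent vector fields -/

variable {A : Type*} [AddCommGroup A] [Module k A]

theorem isPreLie_of_isLieBracket {mA : A →ₗ[k] A →ₗ[k] A}
    (h : IsLieBracket (inducedBracket mA (laurentMul k))) : IsPreLie mA := by
  intro a b c
  have hJ := h.jacobi (a ⊗ₜ laurentPartial k 1) (b ⊗ₜ laurentPartial k 1) (c ⊗ₜ laurentPartial k 0)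
  rw [jacobi_tmul isPerm_laurentMul] at hJ
  have hc := congrArg (contr A (laurentForm k) (laurentPow k (-2) 1)) hJ
  simp only [map_add, contr_tmul, map_zero] at hc
  -- Two rewrites suffice for three pairings: the first two vector fields are both `∂₂`, so the
  -- second and third triple products coincide. Both vanish under the pairing.
  rw [laurentForm_skew, laurentForm_skew (laurentMul k _ _),
    laurentForm_mul_mul, laurentForm_mul_mul] at hc
  refine sub_eq_zero.1 (?_ : preLieDefect mA a b c = 0)
  simpa using hc

theorem isPreLieBialgebra_of_isCompletedLieBialgebra
    {ΔP : LaurentField k →ₗ[k] CompletedTensor (laurentGrading k) (laurentGrading k)}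
    (hΔ : IsInducedCoproduct (laurentGrading k) (laurentMul k) (laurentForm k) ΔP)
    {mA : A →ₗ[k] A →ₗ[k] A} {ΔA : A →ₗ[k] A ⊗[k] A}
    (hL : IsCompletedLieBialgebra (tensorGrading A (laurentGrading k))
      (inducedBracket mA (laurentMul k)) (inducedCobracket (laurentGrading k) ΔA ΔP)) :
    IsPreLieBialgebra mA ΔA := by
  have hQ := isQuadraticGradedPerm_laurent (k := k)
  have hd := isGradedForm_laurentForm (k := k)
  have hmem : ∀ s, laurentPartial k s ∈ laurentGrading k (laurentDeg (0, s)) :=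
    fun s => single_mem_laurentGrading _ _
  have hdeg : ∀ s : Fin 2, ((1, 1) : ℤ × ℤ) - laurentDeg (0, s) + laurentDeg (0, s) = (1, 1) :=
    fun s => sub_add_cancel _ _
  have hcompat : ∀ s t w a b, _ = (0 : A ⊗[k] A) := fun s t w a b =>
    (contr₂_compatible hQ hd mA (hmem s) (hmem t) (hmem w) (hdeg t) (hdeg w) hΔ ΔA a b
      (single_mem_laurentGrading ((0, -2), 1) 1)).symm.trans (by
        rw [hL.compatible, sub_self, Pi.zero_apply, map_zero])
  have hform : ∀ s t w : Fin 2, laurentForm k (Finsupp.single ((0, -2), 1) 1)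
      (laurentMul k (laurentPartial k s) (laurentMul k (laurentPartial k t) (laurentPartial k w)))
      = if s = 1 ∧ t = 1 ∧ w = 0 then 1 else 0 := laurentForm_mul_mul
  simp only [hform] at hcompat
  refine ⟨isPreLie_of_isLieBracket hL.lie, isPreLieCoalgebra_iff.2 fun a => ?_, fun a b => ?_,
    fun a b => ?_⟩
  -- With `q = r = ∂₂` and `s = ∂₁` only the product ending in `s` survives, leaving the unpermuted
  -- defect.
  · have h := (contr₃_coJacobi hQ hd hΔ ΔA (hmem 1) (hmem 1) (hmem 0) (hdeg 1) (hdeg 1) (hdeg 0)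
      (a ⊗ₜ laurentPow k (-2) 1)).symm.trans (by rw [hL.coalgebra.coJacobi, Pi.zero_apply, map_zero])
    simp only [contr_tmul, laurentForm_mul_mul] at h
    have h0 : coPreLieDefect ΔA 0 = 0 := by simp [coPreLieDefect]
    simpa [h0] using h
  -- Placing `∂₁` at `r` isolates `ζ(b, a) - ζ(a, b)`.
  · simpa [sub_eq_zero] using hcompat 1 1 0 a b
  -- Placing `∂₁` at `u` isolates the failure of flip-symmetry of `ζ` at the exchanged pair, hence
  -- the swapped arguments.
  · simpa [sub_eq_zero] using hcompat 0 1 1 b a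

end Laurent

theorem existsUnique_inducedCoproduct {k P G : Type*} [Field k] [AddCommGroup P] [Module k P]
    [AddCommGroup G] [DecidableEq G] {𝒬 : G → Submodule k P} [DirectSum.Decomposition 𝒬]
    {m : P →ₗ[k] P →ₗ[k] P} {κ : P →ₗ[k] P →ₗ[k] k} (hQ : IsQuadraticGradedPerm 𝒬 m κ) :
    ∃! Δ : P →ₗ[k] CompletedTensor 𝒬 𝒬, IsInducedCoproduct 𝒬 m κ Δ := by
  obtain ⟨d, hd⟩ := hQ.graded
  obtain ⟨Δ, hΔ⟩ := exists_inducedCoproduct hQ.finiteDimensional hQ.nondegenerate hd m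
  exact ⟨Δ, hΔ, fun _ h => h.unique hQ.finiteDimensional hQ.nondegenerate hd hΔ⟩

/-! ### Finite-dimensional components -/

theorem finiteDimensional_tensorGrading {k A P G : Type*} [Field k] [AddCommGroup A] [Module k A]
    [AddCommGroup P] [Module k P] (𝒬 : G → Submodule k P) (g : G) [FiniteDimensional k (𝒬 g)]
    [FiniteDimensional k A] : FiniteDimensional k (tensorGrading A 𝒬 g) :=
  Module.Finite.range _

/-- One nonzero component suffices: contraction with `x₂⁻²∂₂` maps the component containing `A ⊗
x₂²∂₁` onto `A`. The preimage of `a` carries a sign because `κ(x₂²∂₁, x₂⁻²∂₂) = -1`. -/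
theorem finiteDimensional_of_tensorGrading {k A : Type*} [Field k] [AddCommGroup A] [Module k A]
    (h : ∀ g, FiniteDimensional k (tensorGrading A (laurentGrading k) g)) :
    FiniteDimensional k A := by
  have := h (laurentDeg ((0, 2), 0))
  refine Module.Finite.of_surjective
    (contrOn A (laurentForm k) (laurentPow k (-2) 1) (laurentDeg ((0, 2), 0))) fun a =>
      ⟨⟨(-a) ⊗ₜ laurentPow k 2 0, tmul_mem_tensorGrading _ (single_mem_laurentGrading _ _)⟩, ?_⟩
  change contr A (laurentForm k) _ ((-a) ⊗ₜ laurentPow k 2 0) = a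
  rw [contr_tmul, laurentPow, laurentPow, laurentForm_single]
  simp [laurentPairing]

end

end AffineBialgebra

/-! ### The main theorem -/

theorem mainTheorem2 {k : Type*} [Field k] [CharZero k] {A : Type*} [AddCommGroup A]
    [Module k A] (mA : A →ₗ[k] A →ₗ[k] A) (ΔA : A →ₗ[k] A ⊗[k] A) :
    (∀ (P : Type*) [AddCommGroup P] [Module k P] (𝒬 : ℤ → Submodule k P)
        [DirectSum.Decomposition 𝒬] (mP : P →ₗ[k] P →ₗ[k] P) (κ : P →ₗ[k] P →ₗ[k] k),
        IsQuadraticGradedPerm 𝒬 mP κ →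
          (∃! ΔP : P →ₗ[k] CompletedTensor 𝒬 𝒬, IsInducedCoproduct 𝒬 mP κ ΔP) ∧
          (IsPreLieBialgebra mA ΔA →
            ∀ ΔP : P →ₗ[k] CompletedTensor 𝒬 𝒬, IsInducedCoproduct 𝒬 mP κ ΔP →
              IsCompletedLieBialgebra (tensorGrading A 𝒬) (inducedBracket mA mP)
                (inducedCobracket 𝒬 ΔA ΔP)) ∧
          (FiniteDimensional k A → ∀ i, FiniteDimensional k (tensorGrading A 𝒬 i))) ∧
    IsQuadraticGradedPerm (laurentGrading k) (laurentMul k) (laurentForm k) ∧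
    (∃! ΔP : LaurentField k →ₗ[k] CompletedTensor (laurentGrading k) (laurentGrading k),
      IsInducedCoproduct (laurentGrading k) (laurentMul k) (laurentForm k) ΔP) ∧
    (∀ ΔP : LaurentField k →ₗ[k] CompletedTensor (laurentGrading k) (laurentGrading k),
      IsInducedCoproduct (laurentGrading k) (laurentMul k) (laurentForm k) ΔP →
        (IsCompletedLieBialgebra (tensorGrading A (laurentGrading k))
            (inducedBracket mA (laurentMul k)) (inducedCobracket (laurentGrading k) ΔA ΔP) ↔
          IsPreLieBialgebra mA ΔA)) ∧
    ((∀ g, FiniteDimensional k (tensorGrading A (laurentGrading k) g)) ↔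
      FiniteDimensional k A) := by
  refine ⟨fun P _ _ 𝒬 _ mP κ hQ => ?_, isQuadraticGradedPerm_laurent,
    existsUnique_inducedCoproduct isQuadraticGradedPerm_laurent, fun ΔP hΔ => ?_, ?_⟩
  · refine ⟨existsUnique_inducedCoproduct hQ,
      fun hA ΔP hΔ => isCompletedLieBialgebra_of_isPreLieBialgebra hQ hΔ hA, fun _ i => ?_⟩
    have := hQ.finiteDimensional i
    exact finiteDimensional_tensorGrading 𝒬 i
  · exact ⟨isPreLieBialgebra_of_isCompletedLieBialgebra hΔ,
      isCompletedLieBialgebra_of_isPreLieBialgebra isQuadraticGradedPerm_laurent hΔ⟩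
  · refine ⟨finiteDimensional_of_tensorGrading, fun _ g => ?_⟩
    have := finiteDimensional_laurentGrading (k := k) g
    exact finiteDimensional_tensorGrading (laurentGrading k) g
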